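/- **Setting.** Let $d\ge 2$ and $K>2$. A problem instance $v=((\mathbf a_i)_{i\in[K]},(\nu_i)_{i\in[K]},\boldsymbol\theta^*,\varepsilon)$ consists of feature vectors $\mathbf a_i\in\mathbb R^d$, reward distributions $\nu_i$ supported in $[0,1]$ with means $\mu_i=\mathbf a_i^\top\boldsymbol\theta^*$, and a privacy parameter $\varepsilon>0$; it is assumed that the best arm $i^*(v)=\arg\max_i\mu_i$ is unique. Let $\Delta_i=\mu_{i^*(v)}-\mu_i$, let $\Delta_{(1)}\le\dots\le\Delta_{(K)}$ be the gaps in nondecreasing order, and $$H_{\rm BAI}(v)=\max_{2\le i\le \min(d^2,K)}\frac{i}{\Delta_{(i)}^2},\qquad H_{\rm pri}(v)=\frac1\varepsilon\max_{2\le i\le \min(d^2,K)}\frac{i}{\Delta_{(i)}}.$$ The reward $X_{i,n}\sim\nu_i$ of the $n$-th pull of arm $i$ ($n\ge1$) is independent over $i$ and $n$. **Schedule.** Let $\lambda=\inf\{\beta\ge2:\beta^{\log d}\ge K-\lceil d^2/4\rceil\}$ (natural logarithm), $g_0=\min\{K,\lceil d^2/4\rceil\}$, $g_i=\lceil g_{i-1}/2\rceil$,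 $h_0=\max\{K-\lceil d^2/4\rceil,0\}$, $h_i=\lceil (h_{i-1}+1)/\lambda\rceil-1$ for $i\ge1$; $M_1=\min\{i\ge1:h_i=0\}$, $M=M_1+\min\{i\ge1:g_i=1\}-1$; $s_p=g_0+h_{p-1}$ for $1\le p\le M_1$ and $s_p=g_{p-M_1}$ for $M_1<p\le M+1$; and, for a budget $T$, $T'=T-M_1d-(M-M_1)\lceil d^2/4\rceil$. **Policy DP-BAI-Gauss** (parameters $\varepsilon$, $0<\delta<1.25$, $T$). Start with $\mathcal A_1=[K]$, $\mathbf a_i^{(0)}=\mathbf a_i$. In phase $p=1,\dots,M$: let $d_p$ be the dimension of the span of $\{\mathbf a_i^{(p-1)}:i\in\mathcal A_p\}$, choose an orthogonal basis of that span, and let $\mathbf a_i^{(p)}\in\mathbb R^{d_p}$ be the coordinate vector of $\mathbf a_i^{(p-1)}$, $i\in\mathcal A_p$. * If $d_p<\sqrt{s_p}$, choose a set $\mathcal B_p\subset\mathcal A_p$ of $d_p$ arms for which the absolute determinant of the matrix with columns $\mathbf a_i^{(p)}$, $i\in\mathcal B_p$, is largest among all sets of $d_p$ arms of $\mathcal A_p$;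 pull each arm of $\mathcal B_p$ exactly $n_p=\lceil T'/(Md_p)\rceil$ times. * If $d_p\ge\sqrt{s_p}$, put $\mathcal B_p=\mathcal A_p$ and pull each arm of $\mathcal A_p$ exactly $n_p=\lceil T'/(Ms_p)\rceil$ times. For $i\in\mathcal B_p$ let $\widetilde\mu^{(p)}_i$ be the mean of the $n_p$ rewards of arm $i$ from this phase plus independent Gaussian noise with mean $0$ and variance $2\log(1.25/\delta)/(\varepsilon n_p)^2$. For $i\in\mathcal A_p\setminus\mathcal B_p$ let $\widetilde\mu_i^{(p)}=\sum_{j\in\mathcal B_p}\alpha_{i,j}\widetilde\mu_j^{(p)}$, where $\mathbf a_i^{(p)}=\sum_{j\in\mathcal B_p}\alpha_{i,j}\mathbf a_j^{(p)}$. Let $\mathcal A_{p+1}$ consist of the $s_{p+1}$ arms of $\mathcal A_p$ with the largest $\widetilde\mu_i^{(p)}$. After phase $M$ return $\hat I_T$, the only arm in $\mathcal A_{M+1}$. The orthogonal bases, the maximising sets $\mathcal B_p$ (if there are several) and the way ties are broken are arbitrary; they may depend on the phase and on the current state of the policy (measurably in the private means). **Proposition.** There is an absolute constant $c>0$ such that,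 for all $d\ge2$, $K>2$, every problem instance $v$ with a unique best arm and every $\delta\in(0,1.25)$, there is $T_0$ (depending on $v$ and $\delta$) such that for all $T\ge T_0$, whatever choices the policy makes, $$\mathbb P_v^{\text{DP-BAI-Gauss}}\big(\hat I_T\ne i^*(v)\big)\le\exp\left(-c\,\min\left\{\frac{T}{H_{\rm BAI}(v)\,\log d},\ \left(\frac{T}{\sqrt{\log(1.25/\delta)}\;H_{\rm pri}(v)\,\log d}\right)^2\right\}\right).$$ -/

import Mathlib

open MeasureTheory ProbabilityTheory

noncomputable section

namespace DPBAI

/-! ### Problem instances and their hardness -/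

/-- A linear bandit instance with `K` arms and `d`-dimensional feature vectors: the feature vectors,
the reward laws (supported in `[0, 1]`, with mean linear in the feature vector), the parameter
vector, the privacy parameter, and the requirement that the best arm is unique. -/
structure BanditInstance (K d : ℕ) where
  feature : Fin K → EuclideanSpace ℝ (Fin d)
  reward : Fin K → ProbabilityMeasure ℝ
  theta : EuclideanSpace ℝ (Fin d)
  eps : ℝ
  eps_pos : 0 < eps
  reward_support : ∀ i, ∀ᵐ x ∂(reward i : Measure ℝ), x ∈ Set.Icc (0 : ℝ) 1
  reward_mean : ∀ i, ∫ x, x ∂(reward i : Measure ℝ) = inner ℝ (feature i) theta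
  exists_best : ∃ i, ∀ j, j ≠ i → inner ℝ (feature j) theta < inner ℝ (feature i) theta

namespace BanditInstance

variable {K d : ℕ}

/-- The mean reward of arm `i`. -/
def mean (v : BanditInstance K d) (i : Fin K) : ℝ := inner ℝ (v.feature i) v.theta

/-- The unique best arm. -/
def best (v : BanditInstance K d) : Fin K := v.exists_best.choose

/-- The sub-optimality gap of arm `i`. -/
def gap (v : BanditInstance K d) (i : Fin K) : ℝ := v.mean v.best - v.mean i

/-- The `i`-th smallest sub-optimality gap, `1 ≤ i ≤ K` (the value for other `i` is not used). -/
def orderedGap (v : BanditInstance K d) (i : ℕ) : ℝ :=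
  if h : i - 1 < K then v.gap (Tuple.sort v.gap ⟨i - 1, h⟩) else 0

/-- `max_{2 ≤ i ≤ min (d ^ 2) K} i / Δ_(i) ^ 2`. -/
def hardnessBAI (v : BanditInstance K d) : ℝ :=
  sSup ((fun i : ℕ => (i : ℝ) / v.orderedGap i ^ 2) '' Set.Icc 2 (min (d ^ 2) K))

/-- `(1 / ε) * max_{2 ≤ i ≤ min (d ^ 2) K} i / Δ_(i)`. -/
def hardnessPri (v : BanditInstance K d) : ℝ :=
  1 / v.eps * sSup ((fun i : ℕ => (i : ℝ) / v.orderedGap i) '' Set.Icc 2 (min (d ^ 2) K))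

end BanditInstance

/-! ### The deterministic schedule of the policy -/

section Schedule

variable (K d : ℕ)

/-- `⌈d ^ 2 / 4⌉`. -/
def quarterSq : ℕ := ⌈(d : ℝ) ^ 2 / 4⌉₊

/-- `λ = inf {β ≥ 2 : β ^ log d ≥ K - ⌈d ^ 2 / 4⌉}`. -/
def lam : ℝ := sInf {β : ℝ | 2 ≤ β ∧ (K : ℝ) - (quarterSq d : ℝ) ≤ β ^ Real.log d}

/-- `g_0 = min {K, ⌈d ^ 2 / 4⌉}`, `g_i = ⌈g_{i-1} / 2⌉`. -/
def gSeq : ℕ → ℕ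
  | 0 => min K (quarterSq d)
  | i + 1 => ⌈(gSeq i : ℝ) / 2⌉₊

/-- `h_0 = max {K - ⌈d ^ 2 / 4⌉, 0}`, `h_i = ⌈(h_{i-1} + 1) / λ⌉ - 1`. -/
def hSeq : ℕ → ℤ
  | 0 => max ((K : ℤ) - (quarterSq d : ℤ)) 0
  | i + 1 => ⌈((hSeq i : ℝ) + 1) / lam K d⌉ - 1

/-- `M₁ = min {i ≥ 1 : h_i = 0}`. -/
def numPhases₁ : ℕ := sInf {i : ℕ | 1 ≤ i ∧ hSeq K d i = 0}

/-- `M = M₁ + min {i ≥ 1 : g_i = 1} - 1`. -/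
def numPhases : ℕ := numPhases₁ K d + sInf {i : ℕ | 1 ≤ i ∧ gSeq K d i = 1} - 1

/-- The number `s_p` of active arms in phase `p` (phases are numbered from `1`):
`s_p = g_0 + h_{p-1}` for `p ≤ M₁` and `s_p = g_{p - M₁}` for `p > M₁`. -/
def numActive (p : ℕ) : ℕ :=
  if p ≤ numPhases₁ K d then gSeq K d 0 + (hSeq K d (p - 1)).toNat
  else gSeq K d (p - numPhases₁ K d)

/-- `T' = T - M₁ d - (M - M₁) ⌈d ^ 2 / 4⌉`. -/
def effBudget (T : ℕ) : ℝ :=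
  (T : ℝ) - (numPhases₁ K d : ℝ) * d
    - ((numPhases K d : ℝ) - (numPhases₁ K d : ℝ)) * (quarterSq d : ℝ)

end Schedule

/-! ### Max-Det collections -/

/-- The absolute value of the determinant of the `n × n` matrix whose columns are the vectors `a i`,
`i ∈ B` (it does not depend on the order in which they are listed). -/
def absDet {K n : ℕ} (a : Fin K → EuclideanSpace ℝ (Fin n)) (B : Finset (Fin K))
    (hB : B.card = n) : ℝ :=
  |(Matrix.of fun r c : Fin n => a (B.orderEmbOfFin hB c) r).det|

/-- `B` is a Max-Det collection of the family `a i`, `i ∈ A`, in `ℝ ^ n`: it consists of `n` of them,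
and no other choice of `n` of them has a larger absolute determinant. -/
def IsMaxDet {K n : ℕ} (a : Fin K → EuclideanSpace ℝ (Fin n)) (A B : Finset (Fin K)) : Prop :=
  B ⊆ A ∧ ∃ hB : B.card = n,
    ∀ B' ⊆ A, ∀ hB' : B'.card = n, absDet a B' hB' ≤ absDet a B hB

open Classical in
/-- Coefficients `α j`, `j ∈ B`, that express `a i` as a linear combination of the `a j`, `j ∈ B`
(they are unique if these vectors form a basis). -/
def coordinates {K n : ℕ} (a : Fin K → EuclideanSpace ℝ (Fin n)) (B : Finset (Fin K))
    (i : Fin K) : Fin K → ℝ :=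
  if h : ∃ α : Fin K → ℝ, (∀ j, j ∉ B → α j = 0) ∧ a i = ∑ j ∈ B, α j • a j then h.choose else 0

/-! ### The policy -/

/-- What the policy remembers between phases: the active set, the current (dimension-reduced)
feature vectors in `ℝ ^ dim`, of which only those of active arms matter, and the number of times
that each arm has been pulled. -/
structure PhaseState (K : ℕ) where
  active : Finset (Fin K)
  dim : ℕ
  vec : Fin K → EuclideanSpace ℝ (Fin dim)
  pulls : Fin K → ℕ

namespace PhaseState

variable {K : ℕ}

/-- The span of the current feature vectors of the active arms. -/
abbrev activeSpan (s : PhaseState K) : Submodule ℝ (EuclideanSpace ℝ (Fin s.dim)) :=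
  Submodule.span ℝ (s.vec '' (s.active : Set (Fin K)))

/-- The dimension of the span of the current feature vectors of the active arms. -/
abbrev rank (s : PhaseState K) : ℕ := Module.finrank ℝ s.activeSpan

open Classical in
/-- Dimensionality reduction: every active feature vector is replaced by its coordinate vector with
respect to a basis `U` of the span of the active feature vectors. -/
def reduce (s : PhaseState K) (U : Module.Basis (Fin s.rank) ℝ s.activeSpan) : PhaseState K where
  active := s.active
  dim := s.rank
  vec := fun i =>
    if h : s.vec i ∈ s.activeSpan then WithLp.toLp 2 (fun k => U.repr ⟨s.vec i, h⟩ k) else 0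
  pulls := s.pulls

end PhaseState

/-- The choices that the description of the policy leaves open: which orthogonal basis is used for
the dimensionality reduction, which Max-Det collection is taken if there are several, and how ties
are broken when the `n` active arms with the largest private empirical means are retained. Each
choice may depend on the phase `p` and on the current state. -/
structure Choices (K : ℕ) where
  basis : ℕ → (s : PhaseState K) → Module.Basis (Fin s.rank) ℝ s.activeSpan
  basis_orthogonal : ∀ p s, Pairwise fun j k =>
    inner ℝ (basis p s j : EuclideanSpace ℝ (Fin s.dim)) (basis p s k) = 0
  maxDet : ℕ → PhaseState K → Finset (Fin K)
  maxDet_spec : ∀ p s, s.dim ≤ s.active.card → IsMaxDet s.vec s.active (maxDet p s)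
  retain : ℕ → PhaseState K → ℕ → (Fin K → ℝ) → Finset (Fin K)
  retain_spec : ∀ p s n m, n ≤ s.active.card →
    retain p s n m ⊆ s.active ∧ (retain p s n m).card = n ∧
      ∀ i ∈ retain p s n m, ∀ j ∈ s.active \ retain p s n m, m j ≤ m i
  retain_measurable : ∀ p s n S, MeasurableSet {m | retain p s n m = S}

section Policy

variable {K : ℕ} (C : Choices K) (d T : ℕ)

/-- The arms pulled in phase `p`; `r` is the state after the dimensionality reduction, so `r.dim`
is `d_p`. -/
def pulledArms (p : ℕ) (r : PhaseState K) : Finset (Fin K) :=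
  if (r.dim : ℝ) < √(numActive K d p : ℝ) then C.maxDet p r else r.active

/-- How often each of these arms is pulled in phase `p`: `⌈T' / (M d_p)⌉` times if
`d_p < √s_p`, and `⌈T' / (M s_p)⌉` times otherwise. -/
def pullCount (p : ℕ) (r : PhaseState K) : ℕ :=
  if (r.dim : ℝ) < √(numActive K d p : ℝ) then
    ⌈effBudget K d T / ((numPhases K d : ℝ) * (r.dim : ℝ))⌉₊
  else
    ⌈effBudget K d T / ((numPhases K d : ℝ) * (numActive K d p : ℝ))⌉₊

/-- The empirical mean of the rewards that arm `i` yields in phase `p`, plus the privacy noise.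
Here `x (i, t)` is the reward of the `t`-th pull of arm `i` (`t = 1, 2, …`), and `ξ (p, i, n)` is
the noise added in phase `p` to the empirical mean of `n` rewards of arm `i`. -/
def noisyMean (x : Fin K × ℕ → ℝ) (ξ : ℕ × Fin K × ℕ → ℝ) (p : ℕ) (r : PhaseState K)
    (i : Fin K) : ℝ :=
  (1 / (pullCount d T p r : ℝ)) *
      ∑ t ∈ Finset.Ioc (r.pulls i) (r.pulls i + pullCount d T p r), x (i, t)
    + ξ (p, i, pullCount d T p r)

/-- The private empirical mean of arm `i` in phase `p`: directly for the arms that are pulled, and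
for the others by linearity from the arms of the Max-Det collection. -/
def privateMean (x : Fin K × ℕ → ℝ) (ξ : ℕ × Fin K × ℕ → ℝ) (p : ℕ) (r : PhaseState K)
    (i : Fin K) : ℝ :=
  if i ∈ pulledArms C d p r then noisyMean d T x ξ p r i
  else ∑ j ∈ pulledArms C d p r,
    coordinates r.vec (pulledArms C d p r) i j * noisyMean d T x ξ p r j

/-- Phase `p` of the policy, after the dimensionality reduction: pull arms, compute the private
empirical means, and retain the `s_{p+1}` active arms with the largest ones. -/
def eliminate (x : Fin K × ℕ → ℝ) (ξ : ℕ × Fin K × ℕ → ℝ) (p : ℕ) (r : PhaseState K) :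
    PhaseState K where
  active := C.retain p r (numActive K d (p + 1)) (privateMean C d T x ξ p r)
  dim := r.dim
  vec := r.vec
  pulls := fun i => r.pulls i + if i ∈ pulledArms C d p r then pullCount d T p r else 0

variable {d}

/-- The state after phases `1, …, p`. -/
def stateAfter (a : Fin K → EuclideanSpace ℝ (Fin d)) (x : Fin K × ℕ → ℝ)
    (ξ : ℕ × Fin K × ℕ → ℝ) : ℕ → PhaseState K
  | 0 => { active := Finset.univ, dim := d, vec := a, pulls := fun _ => 0 }
  | p + 1 =>
    let s := stateAfter a x ξ p
    eliminate C d T x ξ (p + 1) (s.reduce (C.basis (p + 1) s))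

/-- The arm that the policy returns after phase `M`: the only arm that is still active. -/
def recommendation [NeZero K] (a : Fin K → EuclideanSpace ℝ (Fin d)) (x : Fin K × ℕ → ℝ)
    (ξ : ℕ × Fin K × ℕ → ℝ) : Fin K :=
  if h : (stateAfter C T a x ξ (numPhases K d)).active.Nonempty then
    (stateAfter C T a x ξ (numPhases K d)).active.min' h
  else 0

end Policy

/-! ### The probability space -/

/-- The variance `2 log (1.25 / δ) / (ε n) ^ 2` of the Gaussian noise added to an empirical mean of
`n` rewards. -/
def noiseVariance (ε δ : ℝ) (n : ℕ) : NNReal :=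
  Real.toNNReal (2 * Real.log (1.25 / δ) / (ε * n) ^ 2)

/-- The joint law of the rewards `x (i, t)` and of the noise `ξ (p, i, n)`: all of these are
independent, `x (i, t)` has the reward law of arm `i`, and `ξ (p, i, n)` is a centred Gaussian
variable with the variance that belongs to `n` pulls. -/
def law {K d : ℕ} (v : BanditInstance K d) (δ : ℝ) :
    Measure ((Fin K × ℕ → ℝ) × (ℕ × Fin K × ℕ → ℝ)) :=
  (Measure.infinitePi fun q : Fin K × ℕ => (v.reward q.1 : Measure ℝ)).prod
    (Measure.infinitePi fun q : ℕ × Fin K × ℕ => gaussianReal 0 (noiseVariance v.eps δ q.2.2))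

/-- The probability, under the instance `v`, that DP-BAI-Gauss with privacy parameters `v.eps`, `δ`
and budget `T` does not return the best arm. -/
def errorProb {K d : ℕ} [NeZero K] (v : BanditInstance K d) (δ : ℝ) (T : ℕ) (C : Choices K) : ℝ :=
  (law v δ).real {ω | recommendation C T v.feature ω.1 ω.2 ≠ v.best}

end DPBAI

end

namespace DPBAI

/-! ### The schedule -/

section Schedule

variable {K d : ℕ}

/-! The argument is successive elimination. If an active best arm is dropped, each of the s_{p+1}
retained arms has a private mean at least as large as that of the best arm. By pigeonhole one of
them has gap at least Δ_(s_{p+1}+1) (`exists_orderedGap_le`), so its private mean or that of the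
best arm is off by at least half of this gap (`best_mem_retain`).

The error of a private mean is a linear combination of independent centred rewards and Gaussian
noise. Maximality of the determinant bounds the coefficients by 1 (`IsMaxDet.coordinates_spec`).
With m = min(s_p, d²), the error in phase p is therefore sub-Gaussian with proxy mM/(4T') + 2
log(1.25/δ) m²M²/(εT')² (`hasSubgaussianMGF_privateMean`). The schedule gives m ≤ 8 min(s_{p+1}+1,
d²) (`min_numActive_le`) and M ≤ 10 log d (`numPhases_le`), so H_BAI controls the first term and
H_pri the second (`errorExponent_le`).

The states are random, but each is determined by the sets retained so far
(`stateAfter_eq_historyState`). A union bound over all triples (phase, history, arm) replaces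
conditioning: for a fixed history, the pulled indices and the coefficients are deterministic. The
number of triples does not depend on T, so for large T it costs only a factor 2 in the exponent. -/

lemma gSeq_succ (i : ℕ) : gSeq K d (i + 1) = (gSeq K d i + 1) / 2 := by
  rw [gSeq]
  apply le_antisymm
  · rw [Nat.ceil_le]
    have : gSeq K d i ≤ 2 * ((gSeq K d i + 1) / 2) := by omega
    have h : (gSeq K d i : ℝ) ≤ 2 * (((gSeq K d i + 1) / 2 : ℕ) : ℝ) := by exact_mod_cast this
    linarith
  · have h := Nat.le_ceil ((gSeq K d i : ℝ) / 2)
    have h2 : (gSeq K d i : ℝ) ≤ ((2 * ⌈(gSeq K d i : ℝ) / 2⌉₊ : ℕ) : ℝ) := by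
      push_cast; linarith
    have h3 : gSeq K d i ≤ 2 * ⌈(gSeq K d i : ℝ) / 2⌉₊ := by exact_mod_cast h2
    omega

lemma quarterSq_pos (hd : 2 ≤ d) : 1 ≤ quarterSq d := by
  rw [quarterSq, Nat.one_le_ceil_iff]
  positivity

lemma quarterSq_le : quarterSq d ≤ d ^ 2 := by
  rw [quarterSq, Nat.ceil_le]
  push_cast
  nlinarith [sq_nonneg (d : ℝ)]

lemma sq_le_quarterSq : d ^ 2 ≤ 4 * quarterSq d := by
  have h := Nat.le_ceil ((d : ℝ) ^ 2 / 4)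
  have : ((d ^ 2 : ℕ) : ℝ) ≤ ((4 * quarterSq d : ℕ) : ℝ) := by
    rw [quarterSq]; push_cast; linarith
  exact_mod_cast this

lemma gSeq_pos (hd : 2 ≤ d) (hK : 2 < K) (i : ℕ) : 1 ≤ gSeq K d i := by
  induction i with
  | zero => have := quarterSq_pos hd; simp only [gSeq]; omega
  | succ i ih => rw [gSeq_succ]; omega

lemma gSeq_le_pow {i : ℕ} (h : gSeq K d 0 ≤ 2 ^ i) (j : ℕ) (hj : j ≤ i) :
    gSeq K d j ≤ 2 ^ (i - j) := by
  induction j with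
  | zero => simpa using h
  | succ j ih =>
    have h1 := ih (by omega)
    rw [gSeq_succ]
    have : 2 ^ (i - j) = 2 * 2 ^ (i - (j + 1)) := by
      rw [← pow_succ']; congr 1; omega
    omega

lemma gSeq_eq_one (hd : 2 ≤ d) (hK : 2 < K) {i : ℕ} (h : d ^ 2 ≤ 2 ^ i) :
    gSeq K d i = 1 := by
  have h0 : gSeq K d 0 ≤ 2 ^ i := by
    have := quarterSq_le (d := d)
    simp only [gSeq]; omega
  have h1 := gSeq_le_pow h0 i le_rfl
  have h2 := gSeq_pos (K := K) hd hK i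
  simp at h1
  omega

/-- The infimum is attained: the defining set is closed, as β ↦ β^(log d) is continuous for log d >
0. -/
lemma two_le_lam_and (hd : 2 ≤ d) :
    2 ≤ lam K d ∧ (K : ℝ) - (quarterSq d : ℝ) ≤ lam K d ^ Real.log d := by
  have hlog : 0 < Real.log d := Real.log_pos (by exact_mod_cast hd)
  have hclosed : IsClosed {β : ℝ | 2 ≤ β ∧ (K : ℝ) - (quarterSq d : ℝ) ≤ β ^ Real.log d} := by
    apply IsClosed.and
    · exact isClosed_le continuous_const continuous_id
    · exact isClosed_le continuous_const (Real.continuous_rpow_const hlog.le)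
  refine hclosed.csInf_mem ?_ ⟨2, fun β hβ => hβ.1⟩
  have ht := (tendsto_rpow_atTop hlog).eventually_ge_atTop ((K : ℝ) - (quarterSq d : ℝ))
  obtain ⟨β, hβ⟩ := (ht.and (Filter.eventually_ge_atTop 2)).exists
  exact ⟨β, hβ.2, hβ.1⟩

lemma hSeq_nonneg (hd : 2 ≤ d) (i : ℕ) : 0 ≤ hSeq K d i := by
  have hl := (two_le_lam_and (K := K) hd).1
  induction i with
  | zero => simp [hSeq]
  | succ i ih =>
    have h1 : (0 : ℝ) ≤ hSeq K d i := by exact_mod_cast ih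
    have : 0 < ⌈((hSeq K d i : ℝ) + 1) / lam K d⌉ := Int.ceil_pos.mpr (by positivity)
    simp only [hSeq]; omega

lemma hSeq_succ_le (hd : 2 ≤ d) (i : ℕ) : hSeq K d (i + 1) ≤ hSeq K d i := by
  have hl := (two_le_lam_and (K := K) hd).1
  have h1 : (0 : ℝ) ≤ hSeq K d i := by exact_mod_cast hSeq_nonneg hd i
  have : ⌈((hSeq K d i : ℝ) + 1) / lam K d⌉ ≤ hSeq K d i + 1 := by
    rw [Int.ceil_le]
    push_cast
    exact div_le_self (by positivity) (by linarith)
  simp only [hSeq]; omega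

/-- Rounding up adds less than 1 per step, and an accumulated error of 2 reproduces itself because
2/λ + 1 ≤ 2. -/
lemma hSeq_lt (hd : 2 ≤ d) (i : ℕ) :
    (hSeq K d i : ℝ) + 1 < ((hSeq K d 0 : ℝ) + 1) / lam K d ^ i + 2 := by
  have hl := (two_le_lam_and (K := K) hd).1
  induction i with
  | zero => simp
  | succ i ih =>
    have h1 := Int.ceil_lt_add_one (((hSeq K d i : ℝ) + 1) / lam K d)
    have h2 : (hSeq K d (i + 1) : ℝ) + 1 = (⌈((hSeq K d i : ℝ) + 1) / lam K d⌉ : ℝ) := by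
      rw [hSeq]; push_cast; ring
    have h3 : ((hSeq K d i : ℝ) + 1) / lam K d
        < (((hSeq K d 0 : ℝ) + 1) / lam K d ^ i + 2) / lam K d := by
      gcongr
    have h4 : (((hSeq K d 0 : ℝ) + 1) / lam K d ^ i + 2) / lam K d
        = ((hSeq K d 0 : ℝ) + 1) / lam K d ^ (i + 1) + 2 / lam K d := by
      rw [pow_succ]; field_simp
    have h5 : 2 / lam K d ≤ 1 := by rw [div_le_one (by positivity)]; exact hl
    linarith

/-- If h_0 ≥ 1, then h_0 + 1 ≤ 2h_0 ≤ λ^(log d + 1), so k steps bring h down to at most 1; one more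
step gives ⌈2/λ⌉ - 1 = 0. -/
lemma hSeq_eq_zero (hd : 2 ≤ d) {k : ℕ} (hk : Real.log d + 1 ≤ k) : hSeq K d (k + 1) = 0 := by
  obtain ⟨hl, hl2⟩ := two_le_lam_and (K := K) hd
  have h0 : (0 : ℝ) ≤ hSeq K d 0 := by exact_mod_cast hSeq_nonneg hd 0
  have hpow : (hSeq K d 0 : ℝ) + 1 ≤ lam K d ^ k := by
    rcases eq_or_ne (hSeq K d 0) 0 with h | h
    · rw [h]; simp; exact one_le_pow₀ (by linarith)
    · have h1 : 1 ≤ hSeq K d 0 := by have := hSeq_nonneg (K := K) hd 0; omega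
      have h2 : (hSeq K d 0 : ℝ) = (K : ℝ) - (quarterSq d : ℝ) := by
        have : hSeq K d 0 = (K : ℤ) - (quarterSq d : ℤ) := by
          simp only [hSeq] at h1 ⊢; omega
        rw [this]; push_cast; ring
      have h1' : (1 : ℝ) ≤ hSeq K d 0 := by exact_mod_cast h1
      calc (hSeq K d 0 : ℝ) + 1 ≤ hSeq K d 0 * 2 := by linarith
        _ ≤ lam K d ^ Real.log d * lam K d := by
          rw [h2]; gcongr
        _ = lam K d ^ (Real.log d + 1) := by
          rw [Real.rpow_add (by linarith), Real.rpow_one]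
        _ ≤ lam K d ^ (k : ℝ) := Real.rpow_le_rpow_of_exponent_le (by linarith) hk
        _ = lam K d ^ k := Real.rpow_natCast _ _
  have h1 := hSeq_lt (K := K) hd k
  have h2 : ((hSeq K d 0 : ℝ) + 1) / lam K d ^ k ≤ 1 := by
    rw [div_le_one (by positivity)]; exact hpow
  have h3 : (hSeq K d k : ℝ) < 2 := by linarith
  have h4 : hSeq K d k ≤ 1 := by
    have : hSeq K d k < 2 := by exact_mod_cast h3
    omega
  have h5 : ⌈((hSeq K d k : ℝ) + 1) / lam K d⌉ ≤ 1 := by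
    rw [Int.ceil_le]
    rw [div_le_iff₀ (by positivity)]
    have : (hSeq K d k : ℝ) ≤ 1 := by exact_mod_cast h4
    push_cast; linarith
  have h6 := hSeq_nonneg (K := K) hd (k + 1)
  simp only [hSeq] at h6 ⊢
  omega

/-! ### The number of phases is O(log d) -/

lemma numPhases₁_spec (hd : 2 ≤ d) :
    1 ≤ numPhases₁ K d ∧ hSeq K d (numPhases₁ K d) = 0 := by
  have : {i : ℕ | 1 ≤ i ∧ hSeq K d i = 0}.Nonempty :=
    ⟨_, by simp, hSeq_eq_zero hd (Nat.le_ceil (Real.log d + 1))⟩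
  exact Nat.sInf_mem this

lemma numPhases₁_le (hd : 2 ≤ d) : (numPhases₁ K d : ℝ) ≤ Real.log d + 3 := by
  have h1 : numPhases₁ K d ≤ ⌈Real.log d + 1⌉₊ + 1 :=
    Nat.sInf_le ⟨by simp, hSeq_eq_zero hd (Nat.le_ceil (Real.log d + 1))⟩
  have h2 : (numPhases₁ K d : ℝ) ≤ (⌈Real.log d + 1⌉₊ : ℝ) + 1 := by exact_mod_cast h1
  have h3 := Nat.ceil_lt_add_one (a := Real.log d + 1)
    (by have := Real.log_natCast_nonneg d; linarith)
  linarith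

lemma sq_le_two_pow_ceil (hd : 2 ≤ d) : d ^ 2 ≤ 2 ^ ⌈2 * Real.log d / Real.log 2⌉₊ := by
  have h2 : 0 < Real.log 2 := Real.log_pos (by norm_num)
  have h := Nat.le_ceil (2 * Real.log d / Real.log 2)
  rw [div_le_iff₀ h2] at h
  have hd0 : (0 : ℝ) < d := by positivity
  have : Real.log ((d : ℝ) ^ 2) ≤ Real.log ((2 : ℝ) ^ ⌈2 * Real.log d / Real.log 2⌉₊) := by
    rw [Real.log_pow, Real.log_pow]; push_cast; exact h
  rw [Real.log_le_log_iff (by positivity) (by positivity)] at this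
  exact_mod_cast this

lemma one_le_ceil_log (hd : 2 ≤ d) : 1 ≤ ⌈2 * Real.log d / Real.log 2⌉₊ := by
  rw [Nat.one_le_ceil_iff]
  have h2 : 0 < Real.log 2 := Real.log_pos (by norm_num)
  have hlog : 0 < Real.log d := Real.log_pos (by exact_mod_cast hd)
  positivity

lemma exists_numPhases_eq (hd : 2 ≤ d) (hK : 2 < K) : ∃ n : ℕ, 1 ≤ n ∧ gSeq K d n = 1 ∧
    numPhases K d = numPhases₁ K d + n - 1 ∧ (n : ℝ) ≤ 2 * Real.log d / Real.log 2 + 1 := by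
  have hne : 1 ≤ ⌈2 * Real.log d / Real.log 2⌉₊ ∧ gSeq K d ⌈2 * Real.log d / Real.log 2⌉₊ = 1 :=
    ⟨one_le_ceil_log hd, gSeq_eq_one hd hK (sq_le_two_pow_ceil hd)⟩
  have hmem : sInf {i : ℕ | 1 ≤ i ∧ gSeq K d i = 1} ∈ {i : ℕ | 1 ≤ i ∧ gSeq K d i = 1} :=
    Nat.sInf_mem ⟨_, hne⟩
  refine ⟨_, hmem.1, hmem.2, rfl, ?_⟩
  have h1 : sInf {i : ℕ | 1 ≤ i ∧ gSeq K d i = 1} ≤ ⌈2 * Real.log d / Real.log 2⌉₊ :=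
    Nat.sInf_le hne
  have hlog : 0 < Real.log d := Real.log_pos (by exact_mod_cast hd)
  have h2 := Nat.ceil_lt_add_one (a := 2 * Real.log d / Real.log 2)
    (by have h2 : 0 < Real.log 2 := Real.log_pos (by norm_num)
        positivity)
  have h3 : ((sInf {i : ℕ | 1 ≤ i ∧ gSeq K d i = 1} : ℕ) : ℝ)
    ≤ (⌈2 * Real.log d / Real.log 2⌉₊ : ℝ) := by exact_mod_cast h1
  linarith

lemma numPhases_pos (hd : 2 ≤ d) (hK : 2 < K) : 1 ≤ numPhases K d := by
  obtain ⟨n, hn, -, h, -⟩ := exists_numPhases_eq hd hK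
  have := (numPhases₁_spec (K := K) hd).1
  omega

/-- The bounds add up to M ≤ log d + 3 + 2 log d / log 2; the constant 3 is absorbed using log d ≥
log 2. -/
lemma numPhases_le (hd : 2 ≤ d) (hK : 2 < K) : (numPhases K d : ℝ) ≤ 10 * Real.log d := by
  obtain ⟨n, hn, -, h, hle⟩ := exists_numPhases_eq hd hK
  have h1 := numPhases₁_le (K := K) hd
  have h2 : (numPhases K d : ℝ) + 1 = numPhases₁ K d + n := by
    have : numPhases K d + 1 = numPhases₁ K d + n := by omega
    exact_mod_cast this
  have h3 := Real.log_two_gt_d9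
  have h4 : Real.log 2 ≤ Real.log d := Real.log_le_log (by norm_num) (by exact_mod_cast hd)
  have h5 : 2 * Real.log d / Real.log 2 ≤ 3 * Real.log d := by
    rw [div_le_iff₀ (by linarith)]
    nlinarith
  linarith

/-! ### Sizes of the active sets -/

lemma numActive_one (hd : 2 ≤ d) : numActive K d 1 = K := by
  rw [numActive, if_pos (numPhases₁_spec hd).1]
  simp only [gSeq, Nat.sub_self, hSeq]
  omega

lemma numActive_last (hd : 2 ≤ d) (hK : 2 < K) : numActive K d (numPhases K d + 1) = 1 := by
  obtain ⟨n, hn, hg, h, -⟩ := exists_numPhases_eq hd hK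
  have := (numPhases₁_spec (K := K) hd).1
  rw [numActive, if_neg (by omega), ← hg]
  congr 1
  omega

lemma gSeq_succ_le (hd : 2 ≤ d) (hK : 2 < K) (i : ℕ) : gSeq K d (i + 1) ≤ gSeq K d i := by
  have := gSeq_pos (K := K) hd hK i
  rw [gSeq_succ]; omega

lemma numActive_cases (p : ℕ) :
    (numActive K d p = gSeq K d 0 + (hSeq K d (p - 1)).toNat ∧
      (numActive K d (p + 1) = gSeq K d 0 + (hSeq K d p).toNat ∨
        numActive K d (p + 1) = gSeq K d 1)) ∨
    ∃ i, numActive K d p = gSeq K d i ∧ numActive K d (p + 1) = gSeq K d (i + 1) := by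
  simp only [numActive]
  by_cases h1 : p ≤ numPhases₁ K d
  · left
    rw [if_pos h1]
    refine ⟨rfl, ?_⟩
    by_cases h2 : p + 1 ≤ numPhases₁ K d
    · left; rw [if_pos h2]; simp
    · right; rw [if_neg h2]; congr 1; omega
  · right
    rw [if_neg h1, if_neg (by omega)]
    exact ⟨_, rfl, by congr 1; omega⟩

lemma numActive_succ_le (hd : 2 ≤ d) (hK : 2 < K) (p : ℕ) (hp : 1 ≤ p) :
    numActive K d (p + 1) ≤ numActive K d p := by
  rcases numActive_cases (K := K) (d := d) p with ⟨h1, h2 | h2⟩ | ⟨i, h1, h2⟩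
  · rw [h1, h2]
    have := hSeq_succ_le (K := K) hd (p - 1)
    rw [Nat.sub_add_cancel hp] at this
    omega
  · rw [h1, h2]
    have := gSeq_succ_le (K := K) hd hK 0
    simp at this
    omega
  · rw [h1, h2]; exact gSeq_succ_le hd hK i

lemma numActive_pos (hd : 2 ≤ d) (hK : 2 < K) (p : ℕ) : 1 ≤ numActive K d p := by
  rw [numActive]
  split_ifs
  · have := gSeq_pos (K := K) hd hK 0; omega
  · exact gSeq_pos hd hK _

/-- Up to a constant, as many arms are retained in a phase as matter for its variance. -/
lemma min_numActive_le (hd : 2 ≤ d) (hK : 2 < K) (p : ℕ) :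
    min (numActive K d p) (d ^ 2) ≤ 8 * min (numActive K d (p + 1) + 1) (d ^ 2) := by
  -- The cap d² on the right costs nothing, since the left side is at most d².
  suffices h : min (numActive K d p) (d ^ 2) ≤ 8 * (numActive K d (p + 1) + 1) by omega
  have hg := gSeq_succ (K := K) (d := d) 0
  have hq := sq_le_quarterSq (d := d)
  have hg0 : gSeq K d 0 = min K (quarterSq d) := rfl
  simp only [zero_add] at hg
  rcases numActive_cases (K := K) (d := d) p with ⟨h1, h2⟩ | ⟨i, h1, h2⟩
  -- At least g_1 ≥ g_0/2 arms remain. This is at least d²/8 if ⌈d²/4⌉ ≤ K; otherwise g_0 = K ≥ s_p.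
  · have h3 : gSeq K d 1 ≤ numActive K d (p + 1) := by
      rcases h2 with h2 | h2
      · have := gSeq_succ_le (K := K) hd hK 0
        simp only [zero_add] at this
        omega
      · exact h2.ge
    by_cases hKq : quarterSq d ≤ K
    · omega
    · have h4 : numActive K d p ≤ K := by
        have h5 : hSeq K d (p - 1) ≤ hSeq K d 0 :=
          antitone_nat_of_succ_le (fun i => hSeq_succ_le hd i) (Nat.zero_le _)
        simp only [hSeq] at h5
        omega
      omega
  · have := gSeq_succ (K := K) (d := d) i
    omega

end Schedule

/-! ### Gaps -/

namespace BanditInstance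

variable {K d : ℕ} (v : BanditInstance K d)

lemma mean_lt_best {j : Fin K} (hj : j ≠ v.best) : v.mean j < v.mean v.best :=
  v.exists_best.choose_spec j hj

lemma gap_pos {j : Fin K} (hj : j ≠ v.best) : 0 < v.gap j := by
  have := v.mean_lt_best hj
  rw [gap]; linarith

lemma gap_best : v.gap v.best = 0 := by simp [gap]

lemma gap_nonneg (j : Fin K) : 0 ≤ v.gap j := by
  rcases eq_or_ne j v.best with rfl | h
  · rw [gap_best]
  · exact (v.gap_pos h).le

lemma orderedGap_mono {i j : ℕ} (hij : i ≤ j) (h1 : 1 ≤ i) (hj : j ≤ K) :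
    v.orderedGap i ≤ v.orderedGap j := by
  rw [orderedGap, orderedGap, dif_pos (by omega), dif_pos (by omega)]
  exact Tuple.monotone_sort v.gap (by simp only [Fin.mk_le_mk]; omega)

/-- Otherwise the |S| + 1 arms of S ∪ {best} would all have gaps below Δ_(|S|+1), and would fit into
the first |S| places of the sorted order. Nonemptiness of S puts the best arm itself strictly below
this gap. -/
lemma exists_orderedGap_le {S : Finset (Fin K)} (hS : v.best ∉ S) (hne : S.Nonempty) :
    ∃ i ∈ S, v.orderedGap (S.card + 1) ≤ v.gap i := by
  by_contra! hcon
  have hcard : (insert v.best S).card = S.card + 1 := Finset.card_insert_of_notMem hS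
  have hK : S.card + 1 ≤ K := by
    rw [← hcard]; simpa using Finset.card_le_univ (insert v.best S)
  have hn : S.card < K := by omega
  have hval : v.orderedGap (S.card + 1) = v.gap (Tuple.sort v.gap ⟨S.card, hn⟩) := by
    simp only [orderedGap, Nat.add_sub_cancel]
    rw [dif_pos hn]
  have hlt : ∀ i ∈ insert v.best S, v.gap i < v.orderedGap (S.card + 1) := by
    intro i hi
    rcases Finset.mem_insert.1 hi with rfl | hi
    · obtain ⟨j, hj⟩ := hne
      rw [gap_best]
      exact (v.gap_nonneg j).trans_lt (hcon j hj)
    · exact hcon i hi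
  have hsub : insert v.best S ⊆
      (Finset.univ.filter fun j : Fin K => (j : ℕ) < S.card).map
        (Tuple.sort v.gap).toEmbedding := by
    intro i hi
    rw [Finset.mem_map_equiv, Finset.mem_filter]
    refine ⟨Finset.mem_univ _, ?_⟩
    by_contra! hle
    have h1 := hlt i hi
    rw [hval] at h1
    have h2 := Tuple.monotone_sort v.gap
      (show (⟨S.card, hn⟩ : Fin K) ≤ (Tuple.sort v.gap).symm i from hle)
    simp only [Function.comp, Equiv.apply_symm_apply] at h2
    linarith
  have h3 := Finset.card_le_card hsub
  rw [hcard, Finset.card_map, Fin.card_filter_val_lt] at h3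
  omega

lemma orderedGap_pos {i : ℕ} (h2 : 2 ≤ i) (hi : i ≤ K) : 0 < v.orderedGap i := by
  rw [orderedGap, dif_pos (by omega)]
  by_contra! hle
  have hz : Tuple.sort v.gap ⟨i - 1, by omega⟩ = v.best := by
    by_contra hne
    exact absurd (v.gap_pos hne) (not_lt.2 hle)
  have hmono := Tuple.monotone_sort v.gap
    (show (⟨0, by omega⟩ : Fin K) ≤ ⟨i - 1, by omega⟩ by simp)
  simp only [Function.comp] at hmono
  have hz0 : Tuple.sort v.gap ⟨0, by omega⟩ = v.best := by
    by_contra hne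
    exact absurd (v.gap_pos hne) (not_lt.2 (hmono.trans hle))
  have := (Tuple.sort v.gap).injective (hz0.trans hz.symm)
  simp only [Fin.mk.injEq] at this
  omega

lemma le_hardnessBAI {i : ℕ} (h2 : 2 ≤ i) (hi : i ≤ min (d ^ 2) K) :
    (i : ℝ) / v.orderedGap i ^ 2 ≤ v.hardnessBAI :=
  le_csSup ((Set.finite_Icc _ _).image _).bddAbove (Set.mem_image_of_mem _ ⟨h2, hi⟩)

lemma le_hardnessPri {i : ℕ} (h2 : 2 ≤ i) (hi : i ≤ min (d ^ 2) K) :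
    (i : ℝ) / (v.eps * v.orderedGap i) ≤ v.hardnessPri := by
  have : (i : ℝ) / v.orderedGap i ≤
      sSup ((fun i : ℕ => (i : ℝ) / v.orderedGap i) '' Set.Icc 2 (min (d ^ 2) K)) :=
    le_csSup ((Set.finite_Icc _ _).image _).bddAbove
      (Set.mem_image_of_mem (fun i : ℕ => (i : ℝ) / v.orderedGap i) ⟨h2, hi⟩)
  have he := v.eps_pos
  calc (i : ℝ) / (v.eps * v.orderedGap i) = 1 / v.eps * (i / v.orderedGap i) := by
        rw [div_mul_div_comm, one_mul]
    _ ≤ _ := mul_le_mul_of_nonneg_left this (by positivity)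

lemma two_le_min (hd : 2 ≤ d) (hK : 2 < K) : 2 ≤ min (d ^ 2) K := by
  have : 2 * 2 ≤ d * d := Nat.mul_le_mul hd hd
  rw [sq]; omega

lemma hardnessBAI_pos (hd : 2 ≤ d) (hK : 2 < K) : 0 < v.hardnessBAI := by
  have := v.orderedGap_pos le_rfl hK.le
  exact lt_of_lt_of_le (by positivity) (v.le_hardnessBAI le_rfl (two_le_min hd hK))

lemma hardnessPri_pos (hd : 2 ≤ d) (hK : 2 < K) : 0 < v.hardnessPri := by
  have := v.orderedGap_pos le_rfl hK.le
  have := v.eps_pos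
  exact lt_of_lt_of_le (by positivity) (v.le_hardnessPri le_rfl (two_le_min hd hK))

end BanditInstance

/-! ### Concentration -/

lemma hasSubgaussianMGF_gaussianReal (v : NNReal) :
    HasSubgaussianMGF (fun x : ℝ => x) v (gaussianReal 0 v) where
  integrable_exp_mul t := integrable_exp_mul_gaussianReal t
  mgf_le t := by
    rw [mgf_gaussianReal (μ := 0) (v := v) (by simp [Measure.map_id'])]
    simp

variable {K d : ℕ} (v : BanditInstance K d) (δ : ℝ)

instance : IsProbabilityMeasure (law v δ) := by
  unfold law; infer_instance

/-- Hoeffding's lemma on an interval of length 1. -/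
lemma hasSubgaussianMGF_reward (i : Fin K) :
    HasSubgaussianMGF (fun x : ℝ => x - v.mean i) (1 / 4) (v.reward i : Measure ℝ) := by
  have h := hasSubgaussianMGF_of_mem_Icc (μ := (v.reward i : Measure ℝ)) (X := fun x => x)
    aemeasurable_id (v.reward_support i)
  rw [v.reward_mean i] at h
  have h4 : ((‖(1 : ℝ) - 0‖₊ / 2) ^ 2 : NNReal) = 1 / 4 := by
    rw [sub_zero, nnnorm_one]; norm_num
  rwa [h4] at h

lemma HasSubgaussianMGF.const_mul_toNNReal {Ω : Type*} [MeasurableSpace Ω] {μ : Measure Ω}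
    {X : Ω → ℝ} {a : NNReal} (h : HasSubgaussianMGF X a μ) (r : ℝ) :
    HasSubgaussianMGF (fun ω => r * X ω) ((r ^ 2).toNNReal * a) μ := by
  rw [Real.toNNReal_of_nonneg (sq_nonneg r)]
  exact h.const_mul r

lemma hasSubgaussianMGF_sum_rewards (S : Finset (Fin K × ℕ)) (β : Fin K × ℕ → ℝ) :
    HasSubgaussianMGF (fun x : Fin K × ℕ → ℝ => ∑ q ∈ S, β q * (x q - v.mean q.1))
      (∑ q ∈ S, (β q ^ 2).toNNReal * (1 / 4))
      (Measure.infinitePi fun q : Fin K × ℕ => (v.reward q.1 : Measure ℝ)) := by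
  apply HasSubgaussianMGF.sum_of_iIndepFun
  · exact iIndepFun_infinitePi (P := fun q : Fin K × ℕ => (v.reward q.1 : Measure ℝ))
      (X := fun q y => β q * (y - v.mean q.1)) (fun q => by fun_prop)
  · intro q _
    apply HasSubgaussianMGF.const_mul_toNNReal
    exact HasSubgaussianMGF.of_map (Y := fun x : Fin K × ℕ → ℝ => x q)
      (X := fun y => y - v.mean q.1) (measurable_pi_apply q).aemeasurable
      (by rw [Measure.infinitePi_map_eval]; exact hasSubgaussianMGF_reward v q.1)

lemma hasSubgaussianMGF_sum_noise (S : Finset (ℕ × Fin K × ℕ)) (β : ℕ × Fin K × ℕ → ℝ) :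
    HasSubgaussianMGF (fun ξ : ℕ × Fin K × ℕ → ℝ => ∑ q ∈ S, β q * ξ q)
      (∑ q ∈ S, (β q ^ 2).toNNReal * noiseVariance v.eps δ q.2.2)
      (Measure.infinitePi fun q : ℕ × Fin K × ℕ =>
        gaussianReal 0 (noiseVariance v.eps δ q.2.2)) := by
  apply HasSubgaussianMGF.sum_of_iIndepFun
  · exact iIndepFun_infinitePi
      (P := fun q : ℕ × Fin K × ℕ => gaussianReal 0 (noiseVariance v.eps δ q.2.2))
      (X := fun q y => β q * y) (fun q => by fun_prop)
  · intro q _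
    apply HasSubgaussianMGF.const_mul_toNNReal
    exact HasSubgaussianMGF.of_map (Y := fun x : ℕ × Fin K × ℕ → ℝ => x q)
      (X := fun y => y) (measurable_pi_apply q).aemeasurable
      (by rw [Measure.infinitePi_map_eval]; exact hasSubgaussianMGF_gaussianReal _)

lemma HasSubgaussianMGF.fst_add_snd {Ω Ω' : Type*} [MeasurableSpace Ω] [MeasurableSpace Ω']
    {μ : Measure Ω} {ν : Measure Ω'} [IsProbabilityMeasure μ] [IsProbabilityMeasure ν]
    {X : Ω → ℝ} {Y : Ω' → ℝ} {a b : NNReal}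
    (hX : HasSubgaussianMGF X a μ) (hY : HasSubgaussianMGF Y b ν) :
    HasSubgaussianMGF (fun ω : Ω × Ω' => X ω.1 + Y ω.2) (a + b) (μ.prod ν) := by
  apply HasSubgaussianMGF.add_of_indepFun
  · exact HasSubgaussianMGF.of_map (Y := Prod.fst) (X := X) measurable_fst.aemeasurable
      (by simpa using hX)
  · exact HasSubgaussianMGF.of_map (Y := Prod.snd) (X := Y) measurable_snd.aemeasurable
      (by simpa using hY)
  · exact indepFun_prod₀ hX.aemeasurable hY.aemeasurable

lemma HasSubgaussianMGF.measureReal_abs_ge_le {Ω : Type*} [MeasurableSpace Ω]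
    {μ : Measure Ω} [IsFiniteMeasure μ] {X : Ω → ℝ} {a : NNReal} (h : HasSubgaussianMGF X a μ)
    {t : ℝ} (ht : 0 ≤ t) :
    μ.real {ω | t ≤ |X ω|} ≤ 2 * Real.exp (-t ^ 2 / (2 * a)) := by
  have h1 := h.measure_ge_le ht
  have h2 := h.neg.measure_ge_le ht
  have hsub : {ω | t ≤ |X ω|} ⊆ {ω | t ≤ X ω} ∪ {ω | t ≤ (-X) ω} := by
    intro ω hω
    exact le_abs.1 (show t ≤ |X ω| from hω)
  calc μ.real {ω | t ≤ |X ω|} ≤ μ.real ({ω | t ≤ X ω} ∪ {ω | t ≤ (-X) ω}) :=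
        measureReal_mono hsub
    _ ≤ _ := measureReal_union_le _ _
    _ ≤ _ := by linarith

/-- A linear combination of the errors of the private empirical means of one phase. -/
lemma hasSubgaussianMGF_sum_noisyMean (T p : ℕ) (r : PhaseState K) (B : Finset (Fin K))
    (β : Fin K → ℝ) (hn : B.Nonempty → 0 < pullCount d T p r) :
    ∃ a : NNReal, HasSubgaussianMGF (fun ω : (Fin K × ℕ → ℝ) × (ℕ × Fin K × ℕ → ℝ) =>
        ∑ j ∈ B, β j * (noisyMean d T ω.1 ω.2 p r j - v.mean j)) a (law v δ) ∧
      (a : ℝ) = (∑ j ∈ B, β j ^ 2) *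
        (1 / (4 * pullCount d T p r) + noiseVariance v.eps δ (pullCount d T p r)) := by
  rcases B.eq_empty_or_nonempty with rfl | hB
  · exact ⟨0, by simp, by simp⟩
  replace hn := hn hB
  set n := pullCount d T p r with hndef
  have hn' : (0 : ℝ) < n := by exact_mod_cast hn
  -- The state `r` alone fixes the reward and noise indices that enter, so the sums run over
  -- deterministic sets of independent coordinates.
  let S : Finset (Fin K × ℕ) := B.sigma (fun j => Finset.Ioc (r.pulls j) (r.pulls j + n)) |>.map
    (Equiv.sigmaEquivProd _ _).toEmbedding
  let S' : Finset (ℕ × Fin K × ℕ) := B.map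
    ((Function.Embedding.sectL (Fin K) n).trans (Function.Embedding.sectR p (Fin K × ℕ)))
  have h := HasSubgaussianMGF.fst_add_snd
    (hasSubgaussianMGF_sum_rewards v S (fun q => β q.1 / n))
    (hasSubgaussianMGF_sum_noise v δ S' (fun q => β q.2.1))
  refine ⟨_, h.congr (ae_of_all _ fun ω => ?_), ?_⟩
  · simp only [S, S', Finset.sum_map, Finset.sum_sigma,
      Equiv.toEmbedding_apply, Equiv.sigmaEquivProd_apply, Function.Embedding.trans_apply,
      Function.Embedding.sectL_apply, Function.Embedding.sectR_apply, noisyMean, ← hndef]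
    rw [← Finset.sum_add_distrib]
    refine Finset.sum_congr rfl fun j _ => ?_
    rw [← Finset.mul_sum, Finset.sum_sub_distrib, Finset.sum_const, Nat.card_Ioc,
      Nat.add_sub_cancel_left, nsmul_eq_mul]
    field_simp
    ring
  · simp only [S, S', Finset.sum_map, Finset.sum_sigma,
      Equiv.toEmbedding_apply, Equiv.sigmaEquivProd_apply, Function.Embedding.trans_apply,
      Function.Embedding.sectL_apply, Function.Embedding.sectR_apply]
    push_cast
    rw [← Finset.sum_add_distrib, Finset.sum_mul]
    refine Finset.sum_congr rfl fun j _ => ?_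
    rw [Finset.sum_const, Nat.card_Ioc, Nat.add_sub_cancel_left, nsmul_eq_mul]
    rw [Real.coe_toNNReal _ (sq_nonneg _), Real.coe_toNNReal _ (sq_nonneg _)]
    field_simp

lemma coe_noiseVariance {ε : ℝ} (hδ : 0 < δ) (hδ' : δ < 1.25) (n : ℕ) :
    (noiseVariance ε δ n : ℝ) = 2 * Real.log (1.25 / δ) / (ε * n) ^ 2 := by
  have : 0 < Real.log (1.25 / δ) := Real.log_pos (by rw [one_lt_div hδ]; exact hδ')
  rw [noiseVariance, Real.coe_toNNReal]
  positivity

/-! ### Max-Det collections -/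

section MaxDet

variable {K n : ℕ} {a : Fin K → EuclideanSpace ℝ (Fin n)} {A B : Finset (Fin K)}

/-- Listing `B` in another order permutes the columns and changes the determinant only by a sign. -/
lemma absDet_eq (hB : B.card = n) {f : Fin n → Fin K} (hf : Function.Injective f)
    (hfB : ∀ c, f c ∈ B) : absDet a B hB = |(Matrix.of fun r c : Fin n => a (f c) r).det| := by
  let e := B.orderIsoOfFin hB
  have hinj : Function.Injective fun c => e.symm ⟨f c, hfB c⟩ := by
    intro c c' h
    have := e.symm.injective h
    exact hf (by simpa using this)
  let σ : Equiv.Perm (Fin n) := Equiv.ofBijective _ (Finite.injective_iff_bijective.1 hinj)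
  have hσ : ∀ c, B.orderEmbOfFin hB (σ c) = f c := by
    intro c
    rw [← Finset.coe_orderIsoOfFin_apply]
    change ((e (e.symm ⟨f c, hfB c⟩) : B) : Fin K) = f c
    rw [OrderIso.apply_symm_apply]
  have hM : (Matrix.of fun r c : Fin n => a (f c) r) =
      (Matrix.of fun r c : Fin n => a (B.orderEmbOfFin hB c) r).submatrix id σ := by
    ext r c
    simp [hσ]
  rw [hM, Matrix.det_permute', absDet, abs_mul]
  rcases Int.units_eq_one_or (Equiv.Perm.sign σ) with h | h <;> simp [h]

lemma exists_absDet_ne_zero (hspan : Submodule.span ℝ (a '' (A : Set (Fin K))) = ⊤) :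
    ∃ B' ⊆ A, ∃ hB' : B'.card = n, absDet a B' hB' ≠ 0 := by
  have hfr : Module.finrank ℝ (Submodule.span ℝ (a '' (A : Set (Fin K)))) = n := by
    rw [hspan, finrank_top, finrank_euclideanSpace_fin]
  obtain ⟨f, hf, -, hli⟩ := Submodule.exists_fun_fin_finrank_span_eq ℝ (a '' (A : Set (Fin K)))
  let g : Fin n → EuclideanSpace ℝ (Fin n) := fun c => f (Fin.cast hfr.symm c)
  have hg : ∀ c, g c ∈ a '' (A : Set (Fin K)) := fun c => hf _
  have hgli : LinearIndependent ℝ g := hli.comp _ (Fin.cast_injective hfr.symm)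
  choose k hkA hk using hg
  have hkinj : Function.Injective k := by
    intro c c' h
    apply hgli.injective
    rw [← hk c, ← hk c', h]
  refine ⟨Finset.univ.image k, ?_, ?_, ?_⟩
  · intro i hi
    obtain ⟨c, -, rfl⟩ := Finset.mem_image.1 hi
    exact hkA c
  · rw [Finset.card_image_of_injective _ hkinj, Finset.card_univ, Fintype.card_fin]
  · rw [absDet_eq _ hkinj (fun c => Finset.mem_image_of_mem _ (Finset.mem_univ c)), abs_ne_zero,
      ← isUnit_iff_ne_zero, ← Matrix.isUnit_iff_isUnit_det, ← Matrix.linearIndependent_cols_iff_isUnit]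
    have := hgli.map' (WithLp.linearEquiv 2 ℝ (Fin n → ℝ)).toLinearMap (LinearEquiv.ker _)
    have hcol : (Matrix.of fun r c : Fin n => a (k c) r).col =
        (WithLp.linearEquiv 2 ℝ (Fin n → ℝ)).toLinearMap ∘ g := by
      ext c r
      simp [Matrix.col, hk]
    rw [hcol]
    exact this

lemma IsMaxDet.det_ne_zero (h : IsMaxDet a A B)
    (hspan : Submodule.span ℝ (a '' (A : Set (Fin K))) = ⊤) (hB : B.card = n) :
    (Matrix.of fun r c : Fin n => a (B.orderEmbOfFin hB c) r).det ≠ 0 := by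
  obtain ⟨B', hB'A, hB', hne⟩ := exists_absDet_ne_zero hspan
  obtain ⟨-, hB₂, hmax⟩ := h
  have h1 := hmax B' hB'A hB'
  have h2 : 0 < absDet a B' hB' := lt_of_le_of_ne (abs_nonneg _) hne.symm
  exact abs_pos.1 (h2.trans_le h1)

lemma sum_smul_eq_mulVec (hB : B.card = n) (α : Fin K → ℝ) (r : Fin n) :
    (∑ j ∈ B, α j • a j) r =
      (Matrix.of (fun r c : Fin n => a (B.orderEmbOfFin hB c) r)).mulVec
        (fun c => α (B.orderEmbOfFin hB c)) r := by
  have h : ∑ j ∈ B, α j • a j =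
      ∑ c, α (B.orderEmbOfFin hB c) • a (B.orderEmbOfFin hB c) := by
    conv_lhs => rw [← Finset.map_orderEmbOfFin_univ B hB, Finset.sum_map]
    rfl
  rw [h]
  simp [Matrix.mulVec, dotProduct, mul_comm]

/-- The vectors of a Max-Det collection of a spanning family express the other vectors of the
family with coefficients in `[-1, 1]`. -/
lemma IsMaxDet.coordinates_spec (h : IsMaxDet a A B)
    (hspan : Submodule.span ℝ (a '' (A : Set (Fin K))) = ⊤) {i : Fin K} (hiA : i ∈ A)
    (hiB : i ∉ B) :
    a i = ∑ j ∈ B, coordinates a B i j • a j ∧ ∀ j ∈ B, |coordinates a B i j| ≤ 1 := by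
  obtain ⟨hBA, hB, hmax⟩ := id h
  have hdet := h.det_ne_zero hspan hB
  set e := B.orderEmbOfFin hB with he
  set M := Matrix.of fun r c : Fin n => a (e c) r with hM
  have hexists : ∃ α : Fin K → ℝ, (∀ j, j ∉ B → α j = 0) ∧ a i = ∑ j ∈ B, α j • a j := by
    refine ⟨Function.extend e (M⁻¹.mulVec (a i)) 0, fun j hj => ?_, ?_⟩
    · rw [Function.extend_apply', Pi.zero_apply]
      rintro ⟨c, rfl⟩
      exact hj (Finset.orderEmbOfFin_mem B hB c)
    · ext r
      rw [sum_smul_eq_mulVec hB]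
      simp_rw [← he, e.injective.extend_apply]
      change _ = (M.mulVec (M⁻¹.mulVec (a i))) r
      rw [Matrix.mulVec_mulVec, Matrix.mul_nonsing_inv _ (isUnit_iff_ne_zero.2 hdet),
        Matrix.one_mulVec]
  have hcoord : a i = ∑ j ∈ B, coordinates a B i j • a j := by
    rw [coordinates, dif_pos hexists]
    exact hexists.choose_spec.2
  refine ⟨hcoord, fun j hj => ?_⟩
  obtain ⟨c, rfl⟩ : ∃ c, e c = j := by
    have : j ∈ Set.range e := by rw [he, Finset.range_orderEmbOfFin]; exact hj
    exact this
  set x : Fin n → ℝ := fun c => coordinates a B i (e c) with hx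
  have hMx : M.mulVec x = fun r => a i r := by
    ext r
    conv_rhs => rw [hcoord, sum_smul_eq_mulVec hB]
  -- Cramer's rule: replacing the column of `e c` by `a i` multiplies the determinant by the
  -- coefficient `x c`.
  have hcramer : (M.updateCol c (fun r => a i r)).det = M.det * x c := by
    rw [← Matrix.cramer_apply, Matrix.cramer_eq_adjugate_mulVec, ← hMx, Matrix.mulVec_mulVec,
      Matrix.adjugate_mul, Matrix.smul_mulVec, Matrix.one_mulVec, Pi.smul_apply, smul_eq_mul]
  -- Exchanging `e c` for `i` gives a competing collection of `n` arms, so maximality forces |x c| ≤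
  -- 1.
  let f : Fin n → Fin K := Function.update e c i
  have hne : ∀ c', e c' ≠ i := fun c' h' => hiB (h' ▸ Finset.orderEmbOfFin_mem B hB c')
  have hf : Function.Injective f := by
    intro c₁ c₂ h12
    simp only [f, Function.update_apply] at h12
    split_ifs at h12 with h1 h2 h2
    · rw [h1, h2]
    · exact absurd h12.symm (hne _)
    · exact absurd h12 (hne _)
    · exact e.injective h12
  have hupd : M.updateCol c (fun r => a i r) = Matrix.of fun r c' : Fin n => a (f c') r := by
    ext r c'
    simp only [Matrix.updateCol_apply, f, Function.update_apply, Matrix.of_apply, hM]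
    split_ifs <;> rfl
  have hcard : (Finset.univ.image f).card = n := by
    rw [Finset.card_image_of_injective _ hf, Finset.card_univ, Fintype.card_fin]
  have hsub : Finset.univ.image f ⊆ A := by
    intro k hk
    obtain ⟨c', -, rfl⟩ := Finset.mem_image.1 hk
    simp only [f, Function.update_apply]
    split_ifs
    · exact hiA
    · exact hBA (Finset.orderEmbOfFin_mem B hB c')
  have hle := hmax _ hsub hcard
  rw [absDet_eq hcard hf (fun c => Finset.mem_image_of_mem _ (Finset.mem_univ c)), ← hupd,
    hcramer, abs_mul] at hle
  have hle' : |M.det| * |x c| ≤ |M.det| * 1 := by rw [mul_one]; exact hle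
  exact le_of_mul_le_mul_left hle' (abs_pos.2 hdet)

end MaxDet

/-! ### Dimensionality reduction -/

/-- Linearity of the means survives a change of coordinates: the new parameter has entries ⟨U_k, θ⟩.
-/
lemma inner_toLp_repr {E : Type*} [NormedAddCommGroup E] [InnerProductSpace ℝ E]
    {W : Submodule ℝ E} {n : ℕ} (U : Module.Basis (Fin n) ℝ W) (x : W) (θ : E) :
    inner ℝ (WithLp.toLp 2 (fun k => U.repr x k) : EuclideanSpace ℝ (Fin n))
      (WithLp.toLp 2 fun k => inner ℝ (U k : E) θ) = inner ℝ (x : E) θ := by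
  have h : (x : E) = ∑ k, U.repr x k • (U k : E) := by
    have := congrArg W.subtype (U.sum_repr x)
    rw [map_sum] at this
    exact this.symm
  rw [h, sum_inner, PiLp.inner_apply]
  refine Finset.sum_congr rfl fun k _ => ?_
  rw [inner_smul_left]
  simp [mul_comm]

namespace PhaseState

variable {K : ℕ} (s : PhaseState K) (U : Module.Basis (Fin s.rank) ℝ s.activeSpan)

lemma vec_mem_activeSpan {i : Fin K} (hi : i ∈ s.active) : s.vec i ∈ s.activeSpan :=
  Submodule.subset_span (Set.mem_image_of_mem _ hi)

lemma rank_le_card : s.rank ≤ s.active.card := by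
  classical
  have h := finrank_span_finset_le_card (R := ℝ) (s.active.image s.vec)
  rw [Finset.coe_image] at h
  exact h.trans Finset.card_image_le

lemma rank_le_dim : s.rank ≤ s.dim := by
  have h := Submodule.finrank_le s.activeSpan
  rwa [finrank_euclideanSpace_fin] at h

lemma reduce_vec {i : Fin K} (hi : i ∈ s.active) : (s.reduce U).vec i =
    WithLp.toLp 2 (fun k => U.repr ⟨s.vec i, s.vec_mem_activeSpan hi⟩ k) :=
  dif_pos (s.vec_mem_activeSpan hi)

/-- The coordinate map is an isomorphism from the span. The reduced vectors thus span the whole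
space, which makes Max-Det determinants nonzero. -/
lemma span_reduce : Submodule.span ℝ ((s.reduce U).vec '' (s.active : Set (Fin K))) = ⊤ := by
  let L : s.activeSpan ≃ₗ[ℝ] EuclideanSpace ℝ (Fin s.rank) :=
    U.equivFun.trans (WithLp.linearEquiv 2 ℝ (Fin s.rank → ℝ)).symm
  have himg : (s.reduce U).vec '' (s.active : Set (Fin K)) =
      L.toLinearMap '' (((↑) : s.activeSpan → _) ⁻¹' (s.vec '' (s.active : Set (Fin K)))) := by
    ext y
    constructor
    · rintro ⟨i, hi, rfl⟩
      refine ⟨⟨s.vec i, s.vec_mem_activeSpan hi⟩, ⟨i, hi, rfl⟩, ?_⟩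
      rw [s.reduce_vec U hi]
      rfl
    · rintro ⟨⟨x, hx⟩, ⟨i, hi, hix⟩, rfl⟩
      refine ⟨i, hi, ?_⟩
      rw [s.reduce_vec U hi]
      simp only at hix
      subst hix
      rfl
  rw [himg]
  refine (Submodule.span_image L.toLinearMap).trans ?_
  rw [Submodule.span_span_coe_preimage, Submodule.map_top]
  exact LinearEquiv.range L

lemma inner_reduce (θ : EuclideanSpace ℝ (Fin s.dim)) {i : Fin K} (hi : i ∈ s.active) :
    inner ℝ ((s.reduce U).vec i) (WithLp.toLp 2 fun k => inner ℝ (U k : EuclideanSpace ℝ _) θ) =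
      inner ℝ (s.vec i) θ := by
  rw [s.reduce_vec U hi]
  exact inner_toLp_repr U ⟨s.vec i, s.vec_mem_activeSpan hi⟩ θ

end PhaseState

/-! ### The error of the private means in one phase -/

section Phase

variable {K d : ℕ} (v : BanditInstance K d) (δ : ℝ) (C : Choices K) (T p : ℕ)

/-- The means of the active arms are linear in the current feature vectors, whose dimension is at
most `d`. -/
def IsConsistent (s : PhaseState K) : Prop :=
  s.dim ≤ d ∧ ∃ θ, ∀ i ∈ s.active, inner ℝ (s.vec i) θ = v.mean i

variable {v} in
lemma IsConsistent.reduce {s : PhaseState K} (hs : IsConsistent v s)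
    (U : Module.Basis (Fin s.rank) ℝ s.activeSpan) : IsConsistent v (s.reduce U) := by
  obtain ⟨hdim, θ, hθ⟩ := hs
  refine ⟨s.rank_le_dim.trans hdim, WithLp.toLp 2 fun k => inner ℝ (U k : EuclideanSpace ℝ _) θ,
    fun i hi => ?_⟩
  rw [← hθ i hi]
  exact s.inner_reduce U θ hi

/-- For a pulled arm β is an indicator. For any other arm it is the coordinate vector, under which
the true means combine in the same way; its d_p entries are at most 1 in absolute value. -/
lemma privateMean_sub {r : PhaseState K} (hr : IsConsistent v r) (hcard : r.dim ≤ r.active.card)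
    (hspan : Submodule.span ℝ (r.vec '' (r.active : Set (Fin K))) = ⊤) {i : Fin K}
    (hi : i ∈ r.active) :
    ∃ β : Fin K → ℝ, (∀ x ξ, privateMean C d T x ξ p r i - v.mean i =
        ∑ j ∈ pulledArms C d p r, β j * (noisyMean d T x ξ p r j - v.mean j)) ∧
      ∑ j ∈ pulledArms C d p r, β j ^ 2 ≤
        if (r.dim : ℝ) < √(numActive K d p : ℝ) then (r.dim : ℝ) else 1 := by
  classical
  by_cases hiB : i ∈ pulledArms C d p r
  · refine ⟨fun j => if j = i then 1 else 0, fun x ξ => ?_, ?_⟩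
    · rw [privateMean, if_pos hiB]
      simp [hiB]
    · have h1 : ∑ j ∈ pulledArms C d p r, (if j = i then (1 : ℝ) else 0) ^ 2 = 1 := by
        simp [hiB]
      rw [h1]
      split_ifs with h
      · rw [pulledArms, if_pos h] at hiB
        obtain ⟨-, hB, -⟩ := C.maxDet_spec p r hcard
        have : 0 < r.dim := hB ▸ Finset.card_pos.2 ⟨i, hiB⟩
        exact_mod_cast this
      · exact le_rfl
  · have h : (r.dim : ℝ) < √(numActive K d p : ℝ) := by
      by_contra h
      rw [pulledArms, if_neg h] at hiB
      exact hiB hi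
    have hB : pulledArms C d p r = C.maxDet p r := if_pos h
    have hmax : IsMaxDet r.vec r.active (pulledArms C d p r) := hB ▸ C.maxDet_spec p r hcard
    obtain ⟨hsum, hle⟩ := hmax.coordinates_spec hspan hi hiB
    obtain ⟨hBA, hBcard, -⟩ := hmax
    refine ⟨coordinates r.vec (pulledArms C d p r) i, fun x ξ => ?_, ?_⟩
    · obtain ⟨-, θ, hθ⟩ := hr
      have hmean : v.mean i = ∑ j ∈ pulledArms C d p r,
          coordinates r.vec (pulledArms C d p r) i j * v.mean j := by
        rw [← hθ i hi]
        conv_lhs => rw [hsum, sum_inner]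
        refine Finset.sum_congr rfl fun j hj => ?_
        rw [inner_smul_left, hθ j (hBA hj)]
        simp
      rw [privateMean, if_neg hiB]
      conv_lhs => rw [hmean]
      rw [← Finset.sum_sub_distrib]
      exact Finset.sum_congr rfl fun j _ => by ring
    · rw [if_pos h]
      calc ∑ j ∈ pulledArms C d p r, coordinates r.vec (pulledArms C d p r) i j ^ 2
          ≤ ∑ j ∈ pulledArms C d p r, (1 : ℝ) :=
            Finset.sum_le_sum fun j hj => (sq_le_one_iff_abs_le_one _).2 (hle j hj)
        _ = r.dim := by simp [hBcard]

/-- The bound on the variance proxy of a private mean in phase `p`. -/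
noncomputable def varianceBound (ε : ℝ) (K d T p : ℕ) : ℝ :=
  (min (numActive K d p) (d ^ 2) : ℕ) * numPhases K d / (4 * effBudget K d T) +
    2 * Real.log (1.25 / δ) * (min (numActive K d p) (d ^ 2) : ℕ) ^ 2 * numPhases K d ^ 2 /
      (ε * effBudget K d T) ^ 2

/-- Here c bounds the sum of squared coefficients and q is d_p or s_p. The reward variance scales
like q, the privacy variance like q². -/
lemma variance_le {c q n m M T' ε L : ℝ} (hc : 0 ≤ c) (hq : 0 < q) (hM : 0 < M) (hT : 0 < T')
    (hε : 0 < ε) (hL : 0 ≤ L) (hn : T' / (M * q) ≤ n) (h1 : c * q ≤ m) (h2 : c * q ^ 2 ≤ m ^ 2) :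
    c * (1 / (4 * n) + 2 * L / (ε * n) ^ 2) ≤
      m * M / (4 * T') + 2 * L * m ^ 2 * M ^ 2 / (ε * T') ^ 2 := by
  have hb : 0 < T' / (M * q) := by positivity
  calc c * (1 / (4 * n) + 2 * L / (ε * n) ^ 2)
      ≤ c * (1 / (4 * (T' / (M * q))) + 2 * L / (ε * (T' / (M * q))) ^ 2) := by gcongr
    _ = (c * q) * M / (4 * T') + 2 * L * (c * q ^ 2) * M ^ 2 / (ε * T') ^ 2 := by
      field_simp
    _ ≤ _ := by gcongr

variable {δ} in
lemma hasSubgaussianMGF_privateMean (hd : 2 ≤ d) (hK : 2 < K) (hδ : 0 < δ) (hδ' : δ < 1.25)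
    (hT : 0 < effBudget K d T) {r : PhaseState K} (hr : IsConsistent v r)
    (hcard : r.dim ≤ r.active.card)
    (hspan : Submodule.span ℝ (r.vec '' (r.active : Set (Fin K))) = ⊤) {i : Fin K}
    (hi : i ∈ r.active) :
    HasSubgaussianMGF (fun ω : (Fin K × ℕ → ℝ) × (ℕ × Fin K × ℕ → ℝ) =>
      privateMean C d T ω.1 ω.2 p r i - v.mean i) (varianceBound δ v.eps K d T p).toNNReal
        (law v δ) := by
  obtain ⟨β, hβ, hβ2⟩ := privateMean_sub v C T p hr hcard hspan hi
  have hM : (0 : ℝ) < numPhases K d := by exact_mod_cast numPhases_pos hd hK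
  have hs : (0 : ℝ) < numActive K d p := by exact_mod_cast numActive_pos hd hK p
  have hL : 0 < Real.log (1.25 / δ) := Real.log_pos (by rw [one_lt_div hδ]; exact hδ')
  have hε := v.eps_pos
  have hn : (pulledArms C d p r).Nonempty → 0 < pullCount d T p r := by
    intro hne
    rw [pullCount]
    split_ifs with h
    · rw [pulledArms, if_pos h] at hne
      obtain ⟨-, hB, -⟩ := C.maxDet_spec p r hcard
      have : 0 < r.dim := hB ▸ Finset.card_pos.2 hne
      have : (0 : ℝ) < r.dim := by exact_mod_cast this
      exact Nat.ceil_pos.2 (by positivity)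
    · exact Nat.ceil_pos.2 (by positivity)
  obtain ⟨b, hb, hb2⟩ := hasSubgaussianMGF_sum_noisyMean v δ T p r (pulledArms C d p r) β hn
  have hle : b ≤ (varianceBound δ v.eps K d T p).toNNReal := by
    apply NNReal.le_toNNReal_of_coe_le
    rw [hb2, coe_noiseVariance δ hδ hδ']
    refine (mul_le_mul_of_nonneg_right hβ2 (by positivity)).trans ?_
    rw [varianceBound, pullCount]
    split_ifs with h
    -- If all active vectors vanish, then d_p = 0 and no arm is pulled; the coefficient sum is then
    -- 0.
    · rcases r.dim.eq_zero_or_pos with h0 | h0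
      · rw [h0]
        simp only [Nat.cast_zero, zero_mul]
        positivity
      · have hm : r.dim ^ 2 ≤ min (numActive K d p) (d ^ 2) := by
          refine le_min ?_ (Nat.pow_le_pow_left hr.1 2)
          rw [Real.lt_sqrt (by positivity)] at h
          exact_mod_cast h.le
        have hm' : (r.dim : ℝ) ^ 2 ≤ (min (numActive K d p) (d ^ 2) : ℕ) := by exact_mod_cast hm
        have h1 : (1 : ℝ) ≤ r.dim := by exact_mod_cast h0
        refine variance_le (by positivity) (by positivity) hM hT hε hL.le (Nat.le_ceil _)
          (by rw [← sq]; exact hm') ?_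
        -- The privacy term needs d_p³ ≤ d_p⁴ ≤ m².
        calc (r.dim : ℝ) * (r.dim : ℝ) ^ 2 ≤ (r.dim : ℝ) ^ 2 * (r.dim : ℝ) ^ 2 := by
              gcongr; nlinarith
          _ ≤ _ := by rw [← sq]; gcongr
    · rw [not_lt, Real.sqrt_le_left (by positivity)] at h
      have h' : numActive K d p ≤ r.dim ^ 2 := by exact_mod_cast h
      have hm : numActive K d p ≤ min (numActive K d p) (d ^ 2) :=
        le_min le_rfl (h'.trans (Nat.pow_le_pow_left hr.1 2))
      have hm' : (numActive K d p : ℝ) ≤ (min (numActive K d p) (d ^ 2) : ℕ) := by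
        exact_mod_cast hm
      exact variance_le (by positivity) hs hM hT hε hL.le (Nat.le_ceil _)
        (by rw [one_mul]; exact hm') (by rw [one_mul]; gcongr)
  refine ⟨fun t => ?_, fun t => ?_⟩
  · simp_rw [hβ]
    exact hb.integrable_exp_mul t
  · simp_rw [hβ]
    refine (hb.mgf_le t).trans (Real.exp_le_exp.2 ?_)
    gcongr

/-- The gap that matters in phase `p`. -/
noncomputable def phaseGap : ℝ := v.orderedGap (min (numActive K d (p + 1) + 1) (d ^ 2))

/-- The exponent of the error probability, up to a constant. -/
noncomputable def errorExponent : ℝ :=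
  min ((T : ℝ) / (v.hardnessBAI * Real.log d))
    (((T : ℝ) / (√(Real.log (1.25 / δ)) * v.hardnessPri * Real.log d)) ^ 2)

variable {δ T p} in
lemma errorExponent_le (hd : 2 ≤ d) (hK : 2 < K) (hδ : 0 < δ) (hδ' : δ < 1.25) (hT0 : 0 < T)
    (hT : (T : ℝ) / 2 ≤ effBudget K d T) (hp' : numActive K d (p + 1) + 1 ≤ K) :
    1 / 819200 * errorExponent v δ T ≤
      (phaseGap v p / 2) ^ 2 / (2 * varianceBound δ v.eps K d T p) := by
  have hM : (0 : ℝ) < numPhases K d := by exact_mod_cast numPhases_pos hd hK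
  have hM2 := numPhases_le hd hK
  have hL : 0 < Real.log (1.25 / δ) := Real.log_pos (by rw [one_lt_div hδ]; exact hδ')
  have hlog : 0 < Real.log d := Real.log_pos (by exact_mod_cast hd)
  have hε := v.eps_pos
  have hT0' : (0 : ℝ) < T := by exact_mod_cast hT0
  have hT' : 0 < effBudget K d T := by linarith
  have hs := numActive_pos (K := K) hd hK (p + 1)
  have hd2 := BanditInstance.two_le_min (K := K) hd hK
  have hmi := min_numActive_le (K := K) hd hK p
  have hm0 : 0 < min (numActive K d p) (d ^ 2) := by
    have := numActive_pos (K := K) hd hK p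
    omega
  have hi2 : 2 ≤ min (numActive K d (p + 1) + 1) (d ^ 2) := by omega
  have hiK : min (numActive K d (p + 1) + 1) (d ^ 2) ≤ min (d ^ 2) K := by omega
  have hD := v.orderedGap_pos hi2 (by omega)
  have hH := v.le_hardnessBAI hi2 hiK
  have hP := v.le_hardnessPri hi2 hiK
  have hH0 := v.hardnessBAI_pos hd hK
  have hP0 := v.hardnessPri_pos hd hK
  rw [varianceBound, phaseGap, errorExponent]
  set D := v.orderedGap (min (numActive K d (p + 1) + 1) (d ^ 2)) with hDdef
  have hm : ((min (numActive K d p) (d ^ 2) : ℕ) : ℝ) ≤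
    8 * ((min (numActive K d (p + 1) + 1) (d ^ 2) : ℕ) : ℝ) := by exact_mod_cast hmi
  have hm0' : (0 : ℝ) < (min (numActive K d p) (d ^ 2) : ℕ) := by exact_mod_cast hm0
  have hi0 : (0 : ℝ) < (min (numActive K d (p + 1) + 1) (d ^ 2) : ℕ) := by
    exact_mod_cast (by omega : 0 < min (numActive K d (p + 1) + 1) (d ^ 2))
  generalize ((min (numActive K d (p + 1) + 1) (d ^ 2) : ℕ) : ℝ) = i at *
  generalize ((min (numActive K d p) (d ^ 2) : ℕ) : ℝ) = m at *
  generalize effBudget K d T = T' at *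
  generalize (numPhases K d : ℝ) = M at *
  generalize v.hardnessBAI = H at *
  generalize v.hardnessPri = P at *
  generalize Real.log (1.25 / δ) = L at *
  generalize Real.log d = l at *
  generalize v.eps = ε at *
  generalize (T : ℝ) = t at *
  have hi1 : i ≤ H * D ^ 2 := by rwa [div_le_iff₀ (by positivity)] at hH
  have hi3 : i ≤ P * (ε * D) := by rwa [div_le_iff₀ (by positivity)] at hP
  -- 40 = 8 · 10 · 2 / 4, from m ≤ 8i, M ≤ 10 log d and T' ≥ T/2; likewise 51200 = 2 · 8² · 10² · 2²
  -- below.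
  have hW1 : m * M / (4 * T') * min (t / (H * l)) ((t / (√L * P * l)) ^ 2) ≤ 40 * D ^ 2 := by
    calc m * M / (4 * T') * min (t / (H * l)) ((t / (√L * P * l)) ^ 2)
        ≤ (8 * i) * (10 * l) / (4 * (t / 2)) * (t / (H * l)) := by
          gcongr
          exact min_le_left _ _
      _ = 40 * (i / H) := by field_simp; norm_num
      _ ≤ 40 * D ^ 2 := by
          gcongr
          rw [div_le_iff₀ hH0, mul_comm]; exact hi1
  have hW2 : 2 * L * m ^ 2 * M ^ 2 / (ε * T') ^ 2 *
      min (t / (H * l)) ((t / (√L * P * l)) ^ 2) ≤ 51200 * D ^ 2 := by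
    calc 2 * L * m ^ 2 * M ^ 2 / (ε * T') ^ 2 * min (t / (H * l)) ((t / (√L * P * l)) ^ 2)
        ≤ 2 * L * (8 * i) ^ 2 * (10 * l) ^ 2 / (ε * (t / 2)) ^ 2 * (t / (√L * P * l)) ^ 2 := by
          gcongr
          exact min_le_right _ _
      _ = 51200 * (i / (ε * P)) ^ 2 := by
          rw [div_pow t, mul_pow (√L * P), mul_pow √L, Real.sq_sqrt hL.le]; field_simp; norm_num
      _ ≤ 51200 * D ^ 2 := by
          gcongr
          rw [div_le_iff₀ (by positivity)]
          linarith
  -- What remains is 2(40 + 51200)/819200 ≤ 1/4, where 819200 = 16 · 51200.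
  rw [le_div_iff₀ (by positivity)]
  have := sq_nonneg D
  linarith

end Phase

/-! ### The error of the policy -/

section Policy

variable {K d : ℕ} (v : BanditInstance K d) (δ : ℝ) (C : Choices K) (T : ℕ)

/-- The state at the beginning of phase `p`, after the dimensionality reduction, if `s` is the
state after the preceding phase. -/
noncomputable def reducedState (p : ℕ) (s : PhaseState K) : PhaseState K := s.reduce (C.basis p s)

/-- The state after phases `1, …, p`, if `A 0, …, A (p - 1)` are the sets of arms retained in
these phases. It does not depend on the rewards and the noise otherwise. -/
noncomputable def historyState (a : Fin K → EuclideanSpace ℝ (Fin d)) (A : ℕ → Finset (Fin K)) :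
    ℕ → PhaseState K
  | 0 => { active := Finset.univ, dim := d, vec := a, pulls := fun _ => 0 }
  | p + 1 =>
    let r := reducedState C (p + 1) (historyState a A p)
    { active := A p
      dim := r.dim
      vec := r.vec
      pulls := fun i => r.pulls i +
        if i ∈ pulledArms C d (p + 1) r then pullCount d T (p + 1) r else 0 }

/-- Rewards and noise influence later states only through the retained sets, so finitely many
deterministic histories cover all runs. -/
lemma stateAfter_eq_historyState (a : Fin K → EuclideanSpace ℝ (Fin d)) (x : Fin K × ℕ → ℝ)
    (ξ : ℕ × Fin K × ℕ → ℝ) (A : ℕ → Finset (Fin K)) (p : ℕ)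
    (hA : ∀ q < p, A q = (stateAfter C T a x ξ (q + 1)).active) :
    stateAfter C T a x ξ p = historyState C T a A p := by
  induction p with
  | zero => rfl
  | succ p ih =>
    have h := ih fun q hq => hA q (by omega)
    have hAp := hA p (by omega)
    rw [historyState, hAp, ← h]
    rfl

/-- The event that the private mean of the active arm `i` in phase `p + 1` is far from its mean. -/
def deviationEvent (p : ℕ) (s : PhaseState K) (i : Fin K) :
    Set ((Fin K × ℕ → ℝ) × (ℕ × Fin K × ℕ → ℝ)) :=
  {ω | (IsConsistent v s ∧ i ∈ s.active ∧ numActive K d (p + 2) + 1 ≤ K) ∧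
    phaseGap v (p + 1) / 2 ≤
      |privateMean C d T ω.1 ω.2 (p + 1) (reducedState C (p + 1) s) i - v.mean i|}

variable {v T δ} in
lemma measureReal_deviationEvent_le (hd : 2 ≤ d) (hK : 2 < K) (hδ : 0 < δ) (hδ' : δ < 1.25)
    (hT0 : 0 < T) (hT : (T : ℝ) / 2 ≤ effBudget K d T) (p : ℕ) (s : PhaseState K) (i : Fin K) :
    (law v δ).real (deviationEvent v C T p s i) ≤
      2 * Real.exp (-(1 / 819200 * errorExponent v δ T)) := by
  by_cases hgood : IsConsistent v s ∧ i ∈ s.active ∧ numActive K d (p + 2) + 1 ≤ K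
  · obtain ⟨hs, hi, hp⟩ := id hgood
    have hT0' : (0 : ℝ) < T := by exact_mod_cast hT0
    have hT' : 0 < effBudget K d T := by linarith
    have hgap : 0 ≤ phaseGap v (p + 1) / 2 := by
      have h1 := numActive_pos (K := K) hd hK (p + 2)
      have h2 := BanditInstance.two_le_min (K := K) hd hK
      have := v.orderedGap_pos (i := min (numActive K d (p + 2) + 1) (d ^ 2)) (by omega)
        (by omega)
      rw [phaseGap]
      positivity
    have hsub := hasSubgaussianMGF_privateMean v C T (p + 1) hd hK hδ hδ' hT'
      (r := reducedState C (p + 1) s) (hs.reduce _) s.rank_le_card (s.span_reduce _) hi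
    have h1 := HasSubgaussianMGF.measureReal_abs_ge_le hsub hgap
    have h2 := errorExponent_le v hd hK hδ hδ' hT0 hT hp
    have hset : deviationEvent v C T p s i = {ω | phaseGap v (p + 1) / 2 ≤
        |privateMean C d T ω.1 ω.2 (p + 1) (reducedState C (p + 1) s) i - v.mean i|} := by
      ext ω
      exact and_iff_right hgood
    have hW : 0 ≤ varianceBound δ v.eps K d T (p + 1) := by
      have hL : 0 < Real.log (1.25 / δ) := Real.log_pos (by rw [one_lt_div hδ]; exact hδ')
      rw [varianceBound]
      positivity
    rw [hset]
    refine h1.trans ?_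
    rw [Real.coe_toNNReal _ hW, neg_div]
    gcongr
  -- The side conditions built into the event make it empty where the tail bound does not apply, so
  -- the union bound may range over all histories, including impossible ones.
  · have hset : deviationEvent v C T p s i = ∅ := by
      ext ω
      exact iff_of_false (fun h => hgood h.1) (Set.notMem_empty _)
    rw [hset, measureReal_empty]
    positivity

variable {v} in
/-- The best arm survives a phase in which no private mean is far from the mean. -/
lemma best_mem_retain (p : ℕ) {s : PhaseState K} (hs : IsConsistent v s)
    (hd : 2 ≤ d) (hK : 2 < K) (hbest : v.best ∈ s.active)
    (hcard : s.active.card = numActive K d (p + 1)) {ω : (Fin K × ℕ → ℝ) × (ℕ × Fin K × ℕ → ℝ)}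
    (hω : ∀ i, ω ∉ deviationEvent v C T p s i) :
    v.best ∈ C.retain (p + 1) (reducedState C (p + 1) s) (numActive K d (p + 2))
      (privateMean C d T ω.1 ω.2 (p + 1) (reducedState C (p + 1) s)) := by
  have hle : numActive K d (p + 2) ≤ (reducedState C (p + 1) s).active.card :=
    hcard ▸ numActive_succ_le hd hK (p + 1) (by omega)
  obtain ⟨hsub, hc, hmax⟩ := C.retain_spec (p + 1) (reducedState C (p + 1) s)
    (numActive K d (p + 2)) (privateMean C d T ω.1 ω.2 (p + 1) (reducedState C (p + 1) s)) hle
  set R := C.retain (p + 1) (reducedState C (p + 1) s) (numActive K d (p + 2))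
    (privateMean C d T ω.1 ω.2 (p + 1) (reducedState C (p + 1) s))
  by_contra hnot
  have hpos := numActive_pos (K := K) hd hK (p + 2)
  obtain ⟨i, hiR, hi⟩ := v.exists_orderedGap_le hnot (Finset.card_pos.1 (by omega))
  rw [hc] at hi
  -- Losing the best arm means that fewer than K arms were retained, so the index s_{p+1} + 1 is a
  -- valid rank.
  have hKle : numActive K d (p + 2) + 1 ≤ K := by
    rw [← hc, ← Finset.card_insert_of_notMem hnot]
    simpa using Finset.card_le_univ (insert v.best R)
  have hgap : phaseGap v (p + 1) ≤ v.gap i := by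
    have h2 := BanditInstance.two_le_min (K := K) hd hK
    exact (v.orderedGap_mono (min_le_left _ _) (by omega) hKle).trans hi
  have hdev : ∀ j ∈ s.active, |privateMean C d T ω.1 ω.2 (p + 1) (reducedState C (p + 1) s) j -
      v.mean j| < phaseGap v (p + 1) / 2 := by
    intro j hj
    by_contra! h
    exact hω j ⟨⟨hs, hj, hKle⟩, h⟩
  have h1 := abs_lt.1 (hdev i (hsub hiR))
  have h2 := abs_lt.1 (hdev v.best hbest)
  have h3 := hmax i hiR v.best (Finset.mem_sdiff.2 ⟨hbest, hnot⟩)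
  rw [BanditInstance.gap] at hgap
  linarith [h1.1, h1.2, h2.1, h2.2]

variable {v} in
lemma stateAfter_spec (hd : 2 ≤ d) (hK : 2 < K)
    {ω : (Fin K × ℕ → ℝ) × (ℕ × Fin K × ℕ → ℝ)} (p : ℕ)
    (hω : ∀ q < p, ∀ i,
      ω ∉ deviationEvent v C T q (stateAfter C T v.feature ω.1 ω.2 q) i) :
    IsConsistent v (stateAfter C T v.feature ω.1 ω.2 p) ∧
      v.best ∈ (stateAfter C T v.feature ω.1 ω.2 p).active ∧
      (stateAfter C T v.feature ω.1 ω.2 p).active.card = numActive K d (p + 1) := by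
  induction p with
  | zero =>
    refine ⟨⟨le_rfl, v.theta, fun i _ => rfl⟩, Finset.mem_univ _, ?_⟩
    rw [zero_add, numActive_one hd]
    simp [stateAfter]
  | succ p ih =>
    obtain ⟨hs, hbest, hcard⟩ := ih fun q hq => hω q (by omega)
    set s := stateAfter C T v.feature ω.1 ω.2 p with hsdef
    have hle : numActive K d (p + 2) ≤ (reducedState C (p + 1) s).active.card :=
      hcard ▸ numActive_succ_le hd hK (p + 1) (by omega)
    obtain ⟨hsub, hc, -⟩ := C.retain_spec (p + 1) (reducedState C (p + 1) s)
      (numActive K d (p + 2)) (privateMean C d T ω.1 ω.2 (p + 1) (reducedState C (p + 1) s)) hle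
    obtain ⟨hdim, θ, hθ⟩ := hs.reduce (C.basis (p + 1) s)
    exact ⟨⟨hdim, θ, fun i hi => hθ i (hsub hi)⟩,
      best_mem_retain C T p hs hd hK hbest hcard (hω p (by omega)), hc⟩

/-- A sequence of retained sets, extended by the empty set. -/
def extendHistory {M : ℕ} (A : Fin M → Finset (Fin K)) (q : ℕ) : Finset (Fin K) :=
  if h : q < M then A ⟨q, h⟩ else ∅

variable {v} in
lemma error_subset [NeZero K] (hd : 2 ≤ d) (hK : 2 < K) :
    {ω : (Fin K × ℕ → ℝ) × (ℕ × Fin K × ℕ → ℝ) |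
        recommendation C T v.feature ω.1 ω.2 ≠ v.best} ⊆
      ⋃ k : Fin (numPhases K d) × (Fin (numPhases K d) → Finset (Fin K)) × Fin K,
        deviationEvent v C T k.1 (historyState C T v.feature (extendHistory k.2.1) k.1) k.2.2 := by
  intro ω hω
  by_contra hnot
  rw [Set.mem_iUnion, not_exists] at hnot
  apply hω
  obtain ⟨-, hbest, hcard⟩ := stateAfter_spec (v := v) C T hd hK (ω := ω) (numPhases K d)
    (fun q hq i => by
      -- The history used is that of the run itself; the empty sets that extend it are never read
      -- before phase M ends.
      have h := hnot (⟨q, hq⟩, fun q => (stateAfter C T v.feature ω.1 ω.2 (q + 1)).active, i)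
      rwa [← stateAfter_eq_historyState C T v.feature ω.1 ω.2 _ q] at h
      intro q' hq'
      rw [extendHistory, dif_pos (hq'.trans hq)])
  rw [numActive_last hd hK, Finset.card_eq_one] at hcard
  obtain ⟨j, hj⟩ := hcard
  rw [hj, Finset.mem_singleton] at hbest
  rw [recommendation, dif_pos (by rw [hj]; exact Finset.singleton_nonempty j)]
  simp [hj, hbest]

variable {v T δ} in
lemma errorProb_le [NeZero K] (hd : 2 ≤ d) (hK : 2 < K) (hδ : 0 < δ) (hδ' : δ < 1.25)
    (hT0 : 0 < T) (hT : (T : ℝ) / 2 ≤ effBudget K d T) :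
    errorProb v δ T C ≤ Fintype.card
        (Fin (numPhases K d) × (Fin (numPhases K d) → Finset (Fin K)) × Fin K) *
      (2 * Real.exp (-(1 / 819200 * errorExponent v δ T))) := by
  refine (measureReal_mono (error_subset C T hd hK)).trans ?_
  refine (measureReal_iUnion_fintype_le _).trans ?_
  refine (Finset.sum_le_sum fun k _ =>
    measureReal_deviationEvent_le C hd hK hδ hδ' hT0 hT _ _ _).trans ?_
  rw [Finset.sum_const, nsmul_eq_mul, Finset.card_univ]

lemma tendsto_errorExponent (hd : 2 ≤ d) (hK : 2 < K) (hδ : 0 < δ) (hδ' : δ < 1.25) :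
    Filter.Tendsto (errorExponent v δ) Filter.atTop Filter.atTop := by
  have hL : 0 < Real.log (1.25 / δ) := Real.log_pos (by rw [one_lt_div hδ]; exact hδ')
  have hlog : 0 < Real.log d := Real.log_pos (by exact_mod_cast hd)
  have hH := v.hardnessBAI_pos hd hK
  have hP := v.hardnessPri_pos hd hK
  refine Filter.tendsto_inf_atTop _ ?_ ?_
  · exact tendsto_natCast_atTop_atTop.atTop_div_const (by positivity)
  · exact (Filter.tendsto_pow_atTop two_ne_zero).comp
      (tendsto_natCast_atTop_atTop.atTop_div_const (by positivity))

lemma eventually_effBudget : ∀ᶠ T : ℕ in Filter.atTop, (T : ℝ) / 2 ≤ effBudget K d T := by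
  have h := tendsto_natCast_atTop_atTop (R := ℝ) |>.eventually_ge_atTop
    (2 * ((numPhases₁ K d : ℝ) * d
      + ((numPhases K d : ℝ) - (numPhases₁ K d : ℝ)) * (quarterSq d : ℝ)))
  filter_upwards [h] with T hT
  rw [effBudget]
  linarith

end Policy

end DPBAI

/-! ### Conclusion: absorbing the union bound for large budgets -/

theorem mainTheorem8 :
    ∃ c : ℝ, 0 < c ∧
      ∀ (d K : ℕ) [NeZero K], 2 ≤ d → 2 < K →
      ∀ (v : DPBAI.BanditInstance K d) (δ : ℝ), 0 < δ → δ < 1.25 →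
      ∃ T₀ : ℕ, ∀ T : ℕ, T₀ ≤ T → ∀ C : DPBAI.Choices K,
        DPBAI.errorProb v δ T C ≤
          Real.exp (-(c * min ((T : ℝ) / (v.hardnessBAI * Real.log d))
            (((T : ℝ) / (√(Real.log (1.25 / δ)) * v.hardnessPri * Real.log d)) ^ 2))) := by
  -- Half of the rate 1/819200; the other half pays for the factor 2N of the union bound.
  refine ⟨1 / 1638400, by norm_num, fun d K _ hd hK v δ hδ hδ' => ?_⟩
  set N : ℝ := ((Fintype.card
    (Fin (DPBAI.numPhases K d) × (Fin (DPBAI.numPhases K d) → Finset (Fin K)) × Fin K) : ℕ) : ℝ)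
    with hN
  have hlarge := (DPBAI.tendsto_errorExponent v δ hd hK hδ hδ').eventually_ge_atTop
    (1638400 * (2 * N))
  obtain ⟨T₀, hT₀⟩ := Filter.eventually_atTop.1
    ((hlarge.and (DPBAI.eventually_effBudget (K := K) (d := d))).and (Filter.eventually_gt_atTop 0))
  refine ⟨T₀, fun T hT C => ?_⟩
  obtain ⟨⟨h1, h2⟩, h3⟩ := hT₀ T hT
  refine (DPBAI.errorProb_le C hd hK hδ hδ' h3 h2).trans ?_
  rw [← hN]
  change _ ≤ Real.exp (-(1 / 1638400 * DPBAI.errorExponent v δ T))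
  set y := DPBAI.errorExponent v δ T
  -- The choice of `T₀` gives y/1638400 ≥ 2N, and 1 + x ≤ exp x does the rest.
  have h4 : 2 * N ≤ Real.exp (1 / 1638400 * y) := by
    have := Real.add_one_le_exp (1 / 1638400 * y)
    linarith
  calc N * (2 * Real.exp (-(1 / 819200 * y))) = 2 * N * Real.exp (-(1 / 819200 * y)) := by ring
    _ ≤ Real.exp (1 / 1638400 * y) * Real.exp (-(1 / 819200 * y)) := by gcongr
    _ = Real.exp (-(1 / 1638400 * y)) := by rw [← Real.exp_add]; congr 1; ring
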